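/- **Lemma (MGF of the SNR $\Gamma$).** Let $\alpha,\mu,\beta,\lambda,m,\delta,\gamma_0,d_0,R_M>0$ and $\kappa\in\mathbb R$ with $m>\max(2/\alpha,1)$, $\beta>2$, $\delta\in[2,6]$. Let $l\in\mathbb N$, $B_i\in\mathbb R$, $\beta_i\ge 0$ ($1\le i\le l$) be such that $$f_D(d)=\sum_{i=1}^{l}B_i\Big(\frac{d_0}{R_M}\Big)^{\beta_i+1}(d-1)^{\beta_i},\qquad 1<d<1+\tfrac{R_M}{d_0}$$ (and $f_D(d)=0$ for all other $d$) is a probability density. Let $H_{\rm p},H_{\rm f},D$ be independent real random variables such that $D$ has density $f_D$, $H_{\rm p}^2$ has density $f_Z(z)=-\frac{\beta^2}{4}\ln(z)\,z^{\beta/2-1}$ on $0<z<1$, and $H_{\rm f}^2$ has the $\alpha$-$\mathcal F$ density with average-power parameter $w$, $$f_X(x)=\frac{\alpha}{2{\rm B}(\mu,m)}\,r^{m}x^{\frac{\alpha\mu}2-1}\big(x^{\frac\alpha2}+r\big)^{-(m+\mu)},\quad x>0,\qquad r=\frac{(m-1)w^{\alpha/2}}{\lambda^{\alpha/2}\mu},$$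 where the powers are normalized by $\mathbb E[H_{\rm p}^2]\,w=1$ (that is, $\mathbb E[H_{\rm p}^2H_{\rm f}^2]=1$ when $\lambda$ is such that $w=\mathbb E[H_{\rm f}^2]$). The SNR is $$\Gamma=\gamma_0(D-1)^{-\delta}e^{-\kappa d_0D}H_{\rm p}^2H_{\rm f}^2 .$$ For $N\in\mathbb N$ let $x_k$ and $w_k$ ($1\le k\le N$) be the nodes (the roots of the Legendre polynomial of order $N$) and weights of the Gauss–Legendre quadrature on $[-1,1]$. Put $$c_2=\frac{(m-1)(\beta+2)^\alpha}{\lambda^{\alpha/2}\mu\beta^\alpha},\qquad c_1=\frac{\beta^2\alpha}{8{\rm B}(\mu,m)}\,c_2^{\,m},\qquad \Phi(x;[a_1,a_2,a_3])=[a_1(x+1)]^{a_2}e^{a_3[a_1(x+1)+1]},$$ $$\mathbf v_1(i)=\Big[\frac{R_M}{2d_0},\ \beta_i+\frac{\alpha\mu\delta}2,\ \frac\alpha2\kappa\mu d_0\Big],\qquad \mathbf v_2=\Big[\frac{R_M}{2d_0},\ \frac{\alpha\delta}2,\ \frac\alpha2\kappa d_0\Big].$$ Let ${\rm H}^{m',n'}_{p,q}$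 denote the Fox H-function, given by its Mellin–Barnes integral $${\rm H}^{m',n'}_{p,q}\Big[z\,\Big|\begin{array}{c}(a_j,A_j)\\(b_j,B'_j)\end{array}\Big]=\frac1{2\pi {\rm i}}\int_{c-{\rm i}\infty}^{c+{\rm i}\infty}\frac{\prod_{j\le m'}\Gamma(b_j+B'_j\zeta)\prod_{j\le n'}\Gamma(1-a_j-A_j\zeta)}{\prod_{j>m'}\Gamma(1-b_j-B'_j\zeta)\prod_{j>n'}\Gamma(a_j+A_j\zeta)}\,z^{-\zeta}\,d\zeta$$ along a vertical line that has the poles of the $\Gamma(b_j+B'_j\zeta)$, $j\le m'$, on its left and those of the $\Gamma(1-a_j-A_j\zeta)$, $j\le n'$, on its right. For $\gamma>0$ put $$f_{\Gamma,N}(\gamma)=\frac{2R_Mc_1c_2^{-(\mu+m)}}{d_0\gamma_0\Gamma(\mu+m)}\Big(\frac{\gamma}{\gamma_0}\Big)^{\frac{\alpha\mu}2-1}\sum_{i=1}^{l}\sum_{k=1}^{N}B_i\Big(\frac{d_0}{R_M}\Big)^{\beta_i+1}w_k\,\Phi(x_k;\mathbf v_1(i))$$ $$\qquad\times{\rm H}^{3,1}_{3,3}\left[\frac{\Phi(x_k;\mathbf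 v_2)}{c_2}\Big(\frac\gamma{\gamma_0}\Big)^{\frac\alpha2}\,\middle|\,\begin{array}{c}(1-\mu-m,1),(1+\beta-\alpha\mu,\alpha),(1+\beta-\alpha\mu,\alpha)\\(0,1),(\beta-\alpha\mu,\alpha),(\beta-\alpha\mu,\alpha)\end{array}\right]$$ (the $N$-node quadrature form of the density of $\Gamma$), and for $\Re\{s\}>0$ $$M_{\Gamma,N}(s)=\frac{2R_Mc_1c_2^{-m}}{d_0\Gamma(\mu+m)}\sum_{i=1}^{l}\sum_{k=1}^{N}B_i\Big(\frac{d_0}{R_M}\Big)^{\beta_i+1}\frac{w_k\,\Phi(x_k;\mathbf v_1(i))}{[\Phi(x_k;\mathbf v_2)]^{\mu}}\;{\rm H}^{3,2}_{4,3}\left[\frac{\Phi(x_k;\mathbf v_2)}{c_2(s\gamma_0)^{\frac\alpha2}}\,\middle|\,\begin{array}{c}(1,\frac\alpha2),(1-m,1),(1+\beta,\alpha),(1+\beta,\alpha)\\(\mu,1),(\beta,\alpha),(\beta,\alpha)\end{array}\right],$$ where in the last integrand $z^{-\zeta}=\exp(-\zeta L)$ with $L=\ln(\Phi(x_k;\mathbf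 v_2)/c_2)-\frac\alpha2{\rm Log}(s\gamma_0)$ and ${\rm Log}$ the principal logarithm. Then for every $s\in\mathbb C$ with $\Re\{s\}>0$: for every $N$ the Laplace integral below converges absolutely and $$\int_0^\infty f_{\Gamma,N}(\gamma)\,e^{-s\gamma}\,d\gamma=M_{\Gamma,N}(s);$$ and the quadrature form converges to the moment generating function of the SNR, $$\lim_{N\to\infty}M_{\Gamma,N}(s)=M_\Gamma(s)=\mathbb E\big[e^{-s\Gamma}\big].$$ -/

import Mathlib

open MeasureTheory ProbabilityTheory Filter Topology Polynomial

noncomputable section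

/-! ### The Fox H-function -/

/-- The Mellin–Barnes kernel of the Fox H-function `H^{m,n}_{p,q}` with upper parameters
`(a_1, A_1), …, (a_p, A_p)` and lower parameters `(b_1, B_1), …, (b_q, B_q)`:
`∏_{j ≤ m} Γ(b_j + B_j ζ) ∏_{j ≤ n} Γ(1 - a_j - A_j ζ)`
divided by `∏_{j > m} Γ(1 - b_j - B_j ζ) ∏_{j > n} Γ(a_j + A_j ζ)`. -/
def foxHKernel (m n : ℕ) {p q : ℕ} (a : Fin p → ℂ × ℝ) (b : Fin q → ℂ × ℝ) (ζ : ℂ) : ℂ :=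
  (∏ j : Fin q, if (j : ℕ) < m then Complex.Gamma ((b j).1 + (b j).2 * ζ)
    else (Complex.Gamma (1 - (b j).1 - (b j).2 * ζ))⁻¹) *
  (∏ j : Fin p, if (j : ℕ) < n then Complex.Gamma (1 - (a j).1 - (a j).2 * ζ)
    else (Complex.Gamma ((a j).1 + (a j).2 * ζ))⁻¹)

/-- The vertical line `Re ζ = c` separates the poles of `Γ(b_j + B_j ζ)`, `j ≤ m` (which lie to
its left), from the poles of `Γ(1 - a_j - A_j ζ)`, `j ≤ n` (which lie to its right). -/
def FoxHSeparates (m n : ℕ) {p q : ℕ} (a : Fin p → ℂ × ℝ) (b : Fin q → ℂ × ℝ) (c : ℝ) : Prop :=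
  (∀ j : Fin q, (j : ℕ) < m → 0 < (b j).1.re + (b j).2 * c) ∧
  (∀ j : Fin p, (j : ℕ) < n → 0 < 1 - (a j).1.re - (a j).2 * c)

/-- The Mellin–Barnes integral `(1 / 2πi) ∫ kernel(ζ) z^{-ζ} dζ` along the upward line `Re ζ = c`,
with `z^{-ζ} = exp (-ζ L)` where `L` is the chosen logarithm of `z`. -/
def foxHLineIntegral (m n : ℕ) {p q : ℕ} (a : Fin p → ℂ × ℝ) (b : Fin q → ℂ × ℝ) (L : ℂ)
    (c : ℝ) : ℂ :=
  (1 / (2 * Real.pi) : ℂ) *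
    ∫ t : ℝ, foxHKernel m n a b (c + t * Complex.I) * Complex.exp (-(c + t * Complex.I) * L)

open Classical in
/-- The Fox H-function `H^{m,n}_{p,q}[z | a; b]` for parameters whose two families of poles are
separated by a vertical line. As `z^{-ζ} = exp (-ζ (ln |z| + i arg z))`, where `arg z` need not be
the principal argument, the function lives on the Riemann surface of the logarithm; its argument is
given here through `L = ln |z| + i arg z`. By Cauchy's theorem the separating line is irrelevant. -/
def foxH (m n : ℕ) {p q : ℕ} (a : Fin p → ℂ × ℝ) (b : Fin q → ℂ × ℝ) (L : ℂ) : ℂ :=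
  if h : ∃ c : ℝ, FoxHSeparates m n a b c then foxHLineIntegral m n a b L h.choose else 0

/-! ### Gauss–Legendre quadrature on `[-1, 1]` -/

/-- The Legendre polynomial of order `N` (Rodrigues' formula). -/
def legendrePoly (N : ℕ) : ℝ[X] :=
  C (1 / (2 ^ N * (N.factorial : ℝ))) * Polynomial.derivative^[N] ((X ^ 2 - 1) ^ N)

/-- The nodes: the roots of the Legendre polynomial of order `N`. -/
def glNodes (N : ℕ) : Finset ℝ := (legendrePoly N).roots.toFinset

/-- The weight of the node `x`: the integral over `[-1, 1]` of the Lagrange basis polynomial. -/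
def glWeight (N : ℕ) (x : ℝ) : ℝ :=
  ∫ y in (-1 : ℝ)..1, (Lagrange.basis (glNodes N) id x).eval y

/-! ### Channel, misalignment and mobility models -/

/-- PDF of the pointing-error power `Z = H_p ^ 2`. -/
def pointingPDF (β z : ℝ) : ℝ :=
  if 0 < z ∧ z < 1 then -(β ^ 2 / 4) * Real.log z * z ^ (β / 2 - 1) else 0

/-- PDF of the α-F fading power `X = H_f ^ 2` with average-power parameter `w`. -/
def alphaFPDF (α μ m lam w x : ℝ) : ℝ :=
  if 0 < x then
    α / (2 * ProbabilityTheory.beta μ m) *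
      ((m - 1) * w ^ (α / 2) / (lam ^ (α / 2) * μ)) ^ m * x ^ (α * μ / 2 - 1) *
      (x ^ (α / 2) + (m - 1) * w ^ (α / 2) / (lam ^ (α / 2) * μ)) ^ (-(m + μ))
  else 0

/-- Random-waypoint PDF of the normalized distance `D = (R_t + d₀) / d₀`, with coefficients `B` and
exponents `b`. -/
def rwpPDF (d₀ RM : ℝ) {l : ℕ} (B b : Fin l → ℝ) (d : ℝ) : ℝ :=
  if 1 < d ∧ d < 1 + RM / d₀ then
    ∑ i, B i * (d₀ / RM) ^ (b i + 1) * (d - 1) ^ (b i)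
  else 0

/-- Instantaneous SNR at normalized distance `d`, pointing error `hp` and fading envelope `hf`. -/
def snr (γ₀ δ κ d₀ d hp hf : ℝ) : ℝ :=
  γ₀ * (d - 1) ^ (-δ) * Real.exp (-κ * d₀ * d) * hp ^ 2 * hf ^ 2

/-! ### The closed forms -/

def c₂ (α μ β lam m : ℝ) : ℝ := (m - 1) * (β + 2) ^ α / (lam ^ (α / 2) * μ * β ^ α)

def c₁ (α μ β lam m : ℝ) : ℝ :=
  β ^ 2 * α / (8 * ProbabilityTheory.beta μ m) *
    ((m - 1) * (β + 2) ^ α / (β ^ α * lam ^ (α / 2) * μ)) ^ m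

/-- `Φ(x; [a₁, a₂, a₃]) = [a₁ (x + 1)] ^ a₂ * exp (a₃ [a₁ (x + 1) + 1])`. -/
def Phi (x a₁ a₂ a₃ : ℝ) : ℝ := (a₁ * (x + 1)) ^ a₂ * Real.exp (a₃ * (a₁ * (x + 1) + 1))

/-- `Φ(x; v₁(i))`, where `bi` is the `i`-th mobility exponent. -/
def Phi₁ (α μ δ κ d₀ RM bi x : ℝ) : ℝ :=
  Phi x (RM / (2 * d₀)) (bi + α * μ * δ / 2) (α / 2 * κ * μ * d₀)

/-- `Φ(x; v₂)`. -/
def Phi₂ (α δ κ d₀ RM x : ℝ) : ℝ := Phi x (RM / (2 * d₀)) (α * δ / 2) (α / 2 * κ * d₀)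

/-- The `N`-node Gauss–Legendre / Fox-H form of the PDF of the SNR, at `γ > 0`. -/
def snrPDF (α μ β lam m δ γ₀ κ d₀ RM : ℝ) {l : ℕ} (B b : Fin l → ℝ) (N : ℕ) (γ : ℝ) : ℂ :=
  ((2 * RM * c₁ α μ β lam m * c₂ α μ β lam m ^ (-(μ + m)) / (d₀ * γ₀ * Real.Gamma (μ + m)) *
      (γ / γ₀) ^ (α * μ / 2 - 1) : ℝ) : ℂ) *
    ∑ i, ∑ x ∈ glNodes N,
      ((B i * (d₀ / RM) ^ (b i + 1) * glWeight N x * Phi₁ α μ δ κ d₀ RM (b i) x : ℝ) : ℂ) *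
      foxH 3 1
        ![(1 - μ - m, 1), (1 + β - α * μ, α), (1 + β - α * μ, α)]
        ![(0, 1), (β - α * μ, α), (β - α * μ, α)]
        ((Real.log (Phi₂ α δ κ d₀ RM x / c₂ α μ β lam m * (γ / γ₀) ^ (α / 2)) : ℝ) : ℂ)

/-- The `N`-node Gauss–Legendre / Fox-H form of the MGF of the SNR. The argument of the H-function
is `z = Φ(x; v₂) / (c₂ (s γ₀) ^ (α / 2))` with the logarithm
`ln (Φ(x; v₂) / c₂) - (α / 2) Log (s γ₀)`, `Log` being the principal logarithm; this is the
principal logarithm of `z` whenever `α |arg s| < 2π`, in particular if `s` is real or `α ≤ 4`. -/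
def snrMGF (α μ β lam m δ γ₀ κ d₀ RM : ℝ) {l : ℕ} (B b : Fin l → ℝ) (N : ℕ) (s : ℂ) : ℂ :=
  ((2 * RM * c₁ α μ β lam m * c₂ α μ β lam m ^ (-m) / (d₀ * Real.Gamma (μ + m)) : ℝ) : ℂ) *
    ∑ i, ∑ x ∈ glNodes N,
      ((B i * (d₀ / RM) ^ (b i + 1) *
        (glWeight N x * Phi₁ α μ δ κ d₀ RM (b i) x / Phi₂ α δ κ d₀ RM x ^ μ) : ℝ) : ℂ) *
      foxH 3 2
        ![(1, α / 2), (1 - m, 1), (1 + β, α), (1 + β, α)]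
        ![(μ, 1), (β, α), (β, α)]
        (((Real.log (Phi₂ α δ κ d₀ RM x / c₂ α μ β lam m) : ℝ) : ℂ) -
          (α / 2 : ℂ) * Complex.log (s * γ₀))

end

/-!
Conditionally on the distance, the SNR is a deterministic gain times the product `Y = Hp² Hf²`, so
everything reduces to the Laplace transform of `Y` and to the average over the distance.

*The density of `Y`.* The multiplicative convolution of the two power densities is a power of `y`
times `logMixture`, a mixture over the unit interval of the functions `(1 + y z ^ (-α / 2)) ^ (-a)`
with `a = μ + m` (`pointingPDF_mul_alphaFPDF`). Its Mellin transform is `Γ(ζ) Γ(a - ζ) / Γ(a)` times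
a logarithmic moment of the unit interval, that is, `1 / (β - α μ + α ζ) ^ 2` up to a factor. As
`Γ(x) / Γ(1 + x) = 1 / x`, this is the Mellin–Barnes kernel of the `H^{3,1}_{3,3}` in the density.
The quadratic decay of the last factor, together with the bound `|Γ(ζ)| ≤ Γ(Re ζ)`, makes the kernel
integrable on vertical lines without any asymptotics of the Gamma function, and the Mellin inversion
theorem identifies the H-function, along every separating line, with `logMixture`
(`mellinBarnes_eq_logMixture`, `foxH_density_eq`). This replaces the shift of contours by Cauchy's
theorem.

*The Laplace transform.* The substitution `ζ ↦ μ + ζ` carries the separating lines of the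
`H^{3,2}_{4,3}` to those separating lines of the `H^{3,1}_{3,3}` that lie to the left of `μ`. On
these, Fubini's theorem allows integrating `y ^ (α (μ - ζ) / 2 - 1) e ^ (-S y)` first, which gives
the additional factor `Γ(α (μ - ζ) / 2)` of the new kernel (`laplace_densityH`). This proves the
identity for each `N` node by node (`laplace_snrPDF`) and computes the moment generating function
of `Y` (`integral_exp_neg_mul_product`).

*The limit.* By the last formula, the quadrature form is a combination of Gauss–Legendre sums of
`(a₁ (x + 1)) ^ bᵢ` times the conditional moment generating function. The latter extends
continuously by `0` to the end point `x = -1`, where the gain is infinite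
(`continuousOn_scaledMGF`). Gauss–Legendre quadrature converges for continuous integrands, since its
weights are nonnegative, its nodes lie in `(-1, 1)`, and it is exact on polynomials of low degree
(`tendsto_sum_glWeight_mul`); all of this follows from the orthogonality of the Legendre
polynomials. The limit is the average over the distance (`complexMGF_snr_eq`).
-/

/-! ### Gauss–Legendre quadrature -/

lemma eval_iterate_derivative_sq_sub_one_pow {N k : ℕ} (hk : k < N) {x : ℝ} (hx : x ^ 2 = 1) :
    (derivative^[k] ((X ^ 2 - 1 : ℝ[X]) ^ N)).eval x = 0 := by
  obtain ⟨q, hq⟩ := pow_sub_dvd_iterate_derivative_pow (X ^ 2 - 1 : ℝ[X]) N k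
  rw [hq, eval_mul, eval_pow]
  simp [hx, show N - k ≠ 0 by omega]

/-- Repeated integration by parts; the boundary terms vanish because `(X ^ 2 - 1) ^ N` has zeros of
order `N` at `±1`. -/
lemma integral_iterate_derivative_mul {N : ℕ} (k : ℕ) (hk : k ≤ N) (q : ℝ[X]) :
    ∫ x in (-1 : ℝ)..1, (derivative^[k] ((X ^ 2 - 1 : ℝ[X]) ^ N)).eval x * q.eval x =
      (-1) ^ k * ∫ x in (-1 : ℝ)..1,
        ((X ^ 2 - 1 : ℝ[X]) ^ N).eval x * (derivative^[k] q).eval x := by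
  induction k generalizing q with
  | zero => simp
  | succ k ih =>
    have hparts := intervalIntegral.integral_mul_deriv_eq_deriv_mul (a := (-1 : ℝ)) (b := 1)
      (u := fun x => q.eval x) (u' := fun x => (derivative q).eval x)
      (v := fun x => (derivative^[k] ((X ^ 2 - 1 : ℝ[X]) ^ N)).eval x)
      (v' := fun x => (derivative (derivative^[k] ((X ^ 2 - 1 : ℝ[X]) ^ N))).eval x)
      (fun x _ => q.hasDerivAt x) (fun x _ => Polynomial.hasDerivAt _ x)
      ((Polynomial.continuous _).intervalIntegrable _ _)
      ((Polynomial.continuous _).intervalIntegrable _ _)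
    rw [eval_iterate_derivative_sq_sub_one_pow (by omega) (by norm_num),
      eval_iterate_derivative_sq_sub_one_pow (by omega) (by norm_num)] at hparts
    simp only [Function.iterate_succ_apply']
    simp_rw [mul_comm _ (eval _ q)]
    rw [hparts]
    simp_rw [mul_comm (eval _ (derivative q))]
    rw [ih (by omega), ← Function.iterate_succ_apply, ← Function.iterate_succ_apply' derivative,
      pow_succ]
    ring

/-- The Legendre polynomial of order `N` is orthogonal on `[-1, 1]` to all polynomials of degree
less than `N`. -/
lemma integral_legendrePoly_mul_eq_zero {N : ℕ} {q : ℝ[X]} (hq : q.natDegree < N) :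
    ∫ x in (-1 : ℝ)..1, (legendrePoly N).eval x * q.eval x = 0 := by
  simp only [legendrePoly, eval_mul, eval_C, mul_assoc]
  rw [intervalIntegral.integral_const_mul, integral_iterate_derivative_mul N le_rfl,
    iterate_derivative_eq_zero hq]
  simp

lemma card_roots_le_card_roots_iterate_derivative (p : ℝ[X]) (k : ℕ) :
    p.roots.card ≤ (derivative^[k] p).roots.card + k := by
  induction k with
  | zero => simp
  | succ k ih =>
    rw [Function.iterate_succ_apply']
    have := card_roots_le_derivative (derivative^[k] p)
    omega

lemma natDegree_legendrePoly_le (N : ℕ) : (legendrePoly N).natDegree ≤ N := by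
  refine (natDegree_C_mul_le _ _).trans ((natDegree_iterate_derivative _ _).trans ?_)
  have h : ((X ^ 2 - 1 : ℝ[X]) ^ N).natDegree = N * 2 := by
    rw [natDegree_pow, ← C_1, natDegree_X_pow_sub_C]
  omega

/-- By Rolle's theorem all roots of the `N`-th derivative of `(X ^ 2 - 1) ^ N` are real. -/
lemma card_roots_legendrePoly (N : ℕ) : (legendrePoly N).roots.card = N := by
  have hX : (X ^ 2 - 1 : ℝ[X]) = (X - C 1) * (X - C (-1)) := by
    simp only [C_1, C_neg]; ring
  have hne : (X - C 1) * (X - C (-1)) ≠ (0 : ℝ[X]) :=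
    mul_ne_zero (X_sub_C_ne_zero _) (X_sub_C_ne_zero _)
  have h2 : ((X ^ 2 - 1 : ℝ[X]) ^ N).roots.card = N * 2 := by
    rw [roots_pow, hX, roots_mul hne, roots_X_sub_C, roots_X_sub_C]
    simp
  have h3 := card_roots_le_card_roots_iterate_derivative ((X ^ 2 - 1 : ℝ[X]) ^ N) N
  have h4 : (legendrePoly N).roots = (derivative^[N] ((X ^ 2 - 1 : ℝ[X]) ^ N)).roots :=
    roots_C_mul _ (by positivity)
  have h5 := (legendrePoly N).card_roots'
  have h6 := natDegree_legendrePoly_le N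
  rw [h4] at h5 ⊢
  omega

lemma natDegree_legendrePoly (N : ℕ) : (legendrePoly N).natDegree = N :=
  le_antisymm (natDegree_legendrePoly_le N)
    ((card_roots_legendrePoly N).symm.le.trans (card_roots' _))

lemma legendrePoly_ne_zero (N : ℕ) : legendrePoly N ≠ 0 := by
  rcases Nat.eq_zero_or_pos N with rfl | hN
  · simp [legendrePoly]
  · rintro h
    have := natDegree_legendrePoly N
    rw [h, natDegree_zero] at this
    omega

/-- No nonconstant factor of a Legendre polynomial is nonnegative on `[-1, 1]`: otherwise the
cofactor would not be orthogonal to the polynomial. -/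
lemma not_forall_nonneg_of_legendrePoly_eq_mul {N : ℕ} {f q : ℝ[X]} (h : legendrePoly N = f * q)
    (hf : 0 < f.natDegree) : ¬ ∀ x ∈ Set.Icc (-1 : ℝ) 1, 0 ≤ f.eval x := by
  intro hpos
  have hfq : f * q ≠ 0 := h ▸ legendrePoly_ne_zero N
  have hq0 : q ≠ 0 := right_ne_zero_of_mul hfq
  have hdeg : q.natDegree < N := by
    have := natDegree_mul (left_ne_zero_of_mul hfq) hq0
    rw [← h, natDegree_legendrePoly] at this
    omega
  have hint := integral_legendrePoly_mul_eq_zero hdeg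
  have hnn : ∀ x ∈ Set.Icc (-1 : ℝ) 1, 0 ≤ (legendrePoly N).eval x * q.eval x := by
    intro x hx
    rw [h, eval_mul, mul_assoc]
    exact mul_nonneg (hpos x hx) (mul_self_nonneg _)
  have hex : ∃ c ∈ Set.Icc (-1 : ℝ) 1, 0 < (legendrePoly N).eval c * q.eval c := by
    by_contra! hcon
    refine mul_ne_zero (legendrePoly_ne_zero N) hq0 (eq_zero_of_infinite_isRoot _
      ((Set.Icc_infinite (show (-1 : ℝ) < 1 by norm_num)).mono fun x hx => ?_))
    simp only [Set.mem_ofPred_eq, IsRoot, eval_mul]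
    exact le_antisymm (hcon x hx) (hnn x hx)
  exact (intervalIntegral.integral_pos (by norm_num) (by fun_prop)
    (fun x hx => hnn x ⟨hx.1.le, hx.2⟩) hex).ne' hint

/-- The nodes lie in the open interval: a root outside would give a linear factor without sign
change on `[-1, 1]`. -/
lemma mem_Ioo_of_mem_glNodes {N : ℕ} {x : ℝ} (hx : x ∈ glNodes N) : x ∈ Set.Ioo (-1 : ℝ) 1 := by
  rw [glNodes, Multiset.mem_toFinset, mem_roots (legendrePoly_ne_zero N)] at hx
  obtain ⟨q, hq⟩ := dvd_iff_isRoot.mpr hx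
  constructor <;> by_contra! hcon
  · refine not_forall_nonneg_of_legendrePoly_eq_mul hq (by simp) fun y hy => ?_
    simp only [eval_sub, eval_X, eval_C]
    linarith [hy.1]
  · refine not_forall_nonneg_of_legendrePoly_eq_mul (f := -(X - C x)) (q := -q) (by rw [hq]; ring)
      (by rw [natDegree_neg, natDegree_X_sub_C]; exact one_pos) fun y hy => ?_
    simp only [eval_sub, eval_X, eval_C, eval_neg]
    linarith [hy.2]

/-- The roots are simple: a double root would give a square factor. -/
lemma nodup_roots_legendrePoly (N : ℕ) : (legendrePoly N).roots.Nodup := by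
  rw [Multiset.nodup_iff_count_le_one]
  intro x
  by_contra! hcon
  rw [count_roots] at hcon
  obtain ⟨q, hq⟩ := (le_rootMultiplicity_iff (legendrePoly_ne_zero N)).mp hcon
  refine not_forall_nonneg_of_legendrePoly_eq_mul hq (by simp) fun y _ => ?_
  rw [eval_pow]
  exact sq_nonneg _

lemma card_glNodes (N : ℕ) : (glNodes N).card = N := by
  rw [glNodes, Multiset.toFinset_card_of_nodup (nodup_roots_legendrePoly N),
    card_roots_legendrePoly]

lemma legendrePoly_dvd {N : ℕ} {p : ℝ[X]} (hp : ∀ x ∈ glNodes N, p.eval x = 0) :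
    legendrePoly N ∣ p := by
  rcases eq_or_ne p 0 with rfl | hp0
  · exact dvd_zero _
  have hprod := C_leadingCoeff_mul_prod_multiset_X_sub_C
    ((card_roots_legendrePoly N).trans (natDegree_legendrePoly N).symm)
  rw [← hprod]
  have hunit : IsUnit (C (legendrePoly N).leadingCoeff) :=
    isUnit_C.mpr (leadingCoeff_ne_zero.mpr (legendrePoly_ne_zero N)).isUnit
  rw [hunit.mul_left_dvd, Multiset.prod_X_sub_C_dvd_iff_le_roots hp0,
    Multiset.le_iff_subset (nodup_roots_legendrePoly N)]
  intro x hx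
  rw [mem_roots hp0]
  exact hp x (Multiset.mem_toFinset.mpr hx)

/-- The weights are nonnegative: the weight at `x` is the integral of the square of the Lagrange
basis polynomial, since the difference vanishes at the nodes and has degree below `2 N`. -/
lemma glWeight_nonneg {N : ℕ} {x : ℝ} (hx : x ∈ glNodes N) : 0 ≤ glWeight N x := by
  set L := Lagrange.basis (glNodes N) id x with hL
  have hinj : Set.InjOn (id : ℝ → ℝ) (glNodes N) := Set.injOn_id _
  have hLdeg : L.natDegree = N - 1 := by
    rw [hL, Lagrange.natDegree_basis hinj hx, card_glNodes]
  have hNpos : 0 < N := by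
    rw [← card_glNodes N]
    exact Finset.card_pos.mpr ⟨x, hx⟩
  obtain ⟨q, hq⟩ : legendrePoly N ∣ L * L - L := by
    refine legendrePoly_dvd fun y hy => ?_
    rcases eq_or_ne x y with rfl | hxy
    · have := Lagrange.eval_basis_self hinj hx
      simp only [id] at this
      simp [hL, this]
    · have := Lagrange.eval_basis_of_ne (s := glNodes N) (v := id) hxy hy
      simp only [id] at this
      simp [hL, this]
  have hqdeg : q.natDegree < N := by
    rcases eq_or_ne q 0 with rfl | hq0
    · simpa using hNpos
    have h1 := natDegree_mul (legendrePoly_ne_zero N) hq0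
    have h2 : (L * L - L).natDegree ≤ (N - 1) + (N - 1) := by
      refine (natDegree_sub_le _ _).trans (max_le (natDegree_mul_le.trans ?_) ?_) <;> omega
    rw [hq, h1, natDegree_legendrePoly] at h2
    omega
  have hint := integral_legendrePoly_mul_eq_zero hqdeg
  simp_rw [← eval_mul, ← hq, eval_sub] at hint
  rw [intervalIntegral.integral_sub ((Polynomial.continuous _).intervalIntegrable _ _)
    ((Polynomial.continuous _).intervalIntegrable _ _), sub_eq_zero] at hint
  rw [glWeight, ← hL, ← hint]
  refine intervalIntegral.integral_nonneg (by norm_num) fun y _ => ?_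
  rw [eval_mul]
  exact mul_self_nonneg _

/-- The quadrature rule is exact for polynomials of degree less than `N`. -/
lemma sum_glWeight_mul_eval {N : ℕ} {p : ℝ[X]} (hp : p.natDegree < N) :
    ∑ x ∈ glNodes N, glWeight N x * p.eval x = ∫ y in (-1 : ℝ)..1, p.eval y := by
  have hdeg : p.degree < (glNodes N).card := by
    rw [card_glNodes]
    exact degree_le_natDegree.trans_lt (by exact_mod_cast hp)
  have hinter := Lagrange.eq_interpolate (v := id) (Set.injOn_id _) hdeg
  conv_rhs => rw [hinter]
  simp only [Lagrange.interpolate_apply, eval_finsetSum, eval_mul, eval_C, id]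
  rw [intervalIntegral.integral_finsetSum fun x _ => Continuous.intervalIntegrable (by fun_prop) _ _]
  refine Finset.sum_congr rfl fun x _ => ?_
  rw [intervalIntegral.integral_const_mul, glWeight, mul_comm]

lemma tendsto_sum_glWeight_mul_real {f : ℝ → ℝ} (hf : ContinuousOn f (Set.Icc (-1) 1)) :
    Tendsto (fun N => ∑ x ∈ glNodes N, glWeight N x * f x) atTop
      (𝓝 (∫ y in (-1 : ℝ)..1, f y)) := by
  rw [Metric.tendsto_atTop]
  intro ε hε
  obtain ⟨p, hp⟩ := exists_polynomial_near_of_continuousOn (-1) 1 f hf (ε / 5) (by positivity)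
  refine ⟨p.natDegree + 1, fun N hN => ?_⟩
  have hexact := sum_glWeight_mul_eval (N := N) (p := p) (by omega)
  have hone : ∑ x ∈ glNodes N, glWeight N x = 2 := by
    have := sum_glWeight_mul_eval (N := N) (p := 1) (by simp; omega)
    simp only [eval_one, mul_one, intervalIntegral.integral_const, smul_eq_mul] at this
    linarith
  have h1 : |∑ x ∈ glNodes N, glWeight N x * f x - ∑ x ∈ glNodes N, glWeight N x * p.eval x| ≤
      2 * (ε / 5) := by
    rw [← Finset.sum_sub_distrib, ← hone, Finset.sum_mul]
    refine (Finset.abs_sum_le_sum_abs _ _).trans (Finset.sum_le_sum fun x hx => ?_)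
    rw [← mul_sub, abs_mul, abs_of_nonneg (glWeight_nonneg hx), abs_sub_comm]
    have hx' := mem_Ioo_of_mem_glNodes hx
    exact mul_le_mul_of_nonneg_left (hp x ⟨hx'.1.le, hx'.2.le⟩).le (glWeight_nonneg hx)
  have h2 : |(∫ y in (-1 : ℝ)..1, p.eval y) - ∫ y in (-1 : ℝ)..1, f y| ≤ 2 * (ε / 5) := by
    have hfi : IntervalIntegrable f volume (-1) 1 :=
      ContinuousOn.intervalIntegrable (by rwa [Set.uIcc_of_le (by norm_num)])
    rw [← intervalIntegral.integral_sub ((Polynomial.continuous _).intervalIntegrable _ _) hfi]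
    rw [← Real.norm_eq_abs]
    refine (intervalIntegral.norm_integral_le_of_norm_le_const (C := ε / 5) fun x hx => ?_).trans ?_
    · rw [Set.uIoc_of_le (by norm_num)] at hx
      exact (hp x ⟨hx.1.le, hx.2⟩).le
    · norm_num
      linarith
  rw [hexact] at h1
  rw [Real.dist_eq]
  have := abs_sub_le (∑ x ∈ glNodes N, glWeight N x * f x) (∫ y in (-1 : ℝ)..1, p.eval y)
    (∫ y in (-1 : ℝ)..1, f y)
  linarith

/-- Gauss–Legendre quadrature converges for continuous integrands. -/
theorem tendsto_sum_glWeight_mul {f : ℝ → ℂ} (hf : ContinuousOn f (Set.Icc (-1) 1)) :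
    Tendsto (fun N => ∑ x ∈ glNodes N, (glWeight N x : ℂ) * f x) atTop
      (𝓝 (∫ y in (-1 : ℝ)..1, f y)) := by
  have hfi : IntervalIntegrable f volume (-1) 1 :=
    ContinuousOn.intervalIntegrable (by rwa [Set.uIcc_of_le (by norm_num)])
  have hre := tendsto_sum_glWeight_mul_real (Complex.continuous_re.comp_continuousOn hf)
  have him := tendsto_sum_glWeight_mul_real (Complex.continuous_im.comp_continuousOn hf)
  have key := ((Complex.continuous_ofReal.tendsto _).comp hre).add
    (((Complex.continuous_ofReal.tendsto _).comp him).mul_const Complex.I)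
  have hlim : ∫ y in (-1 : ℝ)..1, f y =
      ((∫ y in (-1 : ℝ)..1, (f y).re : ℝ) : ℂ) + ((∫ y in (-1 : ℝ)..1, (f y).im : ℝ) : ℂ) *
        Complex.I := by
    rw [intervalIntegral.integral_of_le (by norm_num), intervalIntegral.integral_of_le (by norm_num),
      intervalIntegral.integral_of_le (by norm_num)]
    exact (integral_re_add_im (𝕜 := ℂ) hfi.1).symm
  rw [hlim]
  refine key.congr fun N => ?_
  simp only [Function.comp_apply, Complex.ofReal_sum, Complex.ofReal_mul, Finset.sum_mul]
  rw [← Finset.sum_add_distrib]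
  refine Finset.sum_congr rfl fun x _ => ?_
  conv_rhs => rw [← Complex.re_add_im (f x)]
  ring

/-! ### Mellin transforms -/

/-- The Mellin transform turns a scale mixture `y ↦ ∫ k(x) g(h(x) y) dν(x)` into a product. -/
lemma hasMellin_integral_comp_mul {X : Type*} [MeasurableSpace X] {ν : Measure X} [SFinite ν]
    {k h : X → ℝ} {g : ℝ → ℂ} {ζ : ℂ} (hk : Measurable k) (hh : Measurable h) (hg : Measurable g)
    (hpos : ∀ᵐ x ∂ν, 0 < h x) (hconv : MellinConvergent g ζ)
    (hint : Integrable (fun x => k x * h x ^ (-ζ.re)) ν) :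
    HasMellin (fun y => ∫ x, (k x : ℂ) * g (h x * y) ∂ν) ζ
      ((∫ x, (k x : ℂ) * (h x : ℂ) ^ (-ζ) ∂ν) * mellin g ζ) := by
  set F : ℝ → X → ℂ := fun y x => (y : ℂ) ^ (ζ - 1) * ((k x : ℂ) * g (h x * y)) with hF
  have hmeas : Measurable (Function.uncurry F) := by
    simp only [hF, Function.uncurry_def]
    fun_prop
  have hinner : ∀ᵐ x ∂ν, ∫ y in Set.Ioi (0 : ℝ), F y x =
      (k x : ℂ) * (h x : ℂ) ^ (-ζ) * mellin g ζ := by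
    filter_upwards [hpos] with x hx
    have h1 := mellin_comp_mul_left g ζ hx
    simp only [mellin, smul_eq_mul] at h1
    simp only [hF, mul_left_comm _ (k x : ℂ)]
    rw [integral_const_mul, h1, mellin]
    simp only [smul_eq_mul, mul_assoc]
  have hInt : Integrable (Function.uncurry F) ((volume.restrict (Set.Ioi 0)).prod ν) := by
    refine (integrable_prod_iff' hmeas.aestronglyMeasurable).mpr ⟨?_, ?_⟩
    · filter_upwards [hpos] with x hx
      have h1 : Integrable _ _ := (MellinConvergent.comp_mul_left (f := g) (s := ζ) hx).mpr hconv
      refine (h1.const_mul (k x : ℂ)).congr (ae_of_all _ fun y => ?_)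
      simp only [Function.uncurry, hF, smul_eq_mul]
      ring
    · refine (hint.norm.mul_const
        (∫ y in Set.Ioi (0 : ℝ), y ^ (ζ.re - 1) * ‖g y‖)).congr ?_
      filter_upwards [hpos] with x hx
      have h2 := integral_comp_mul_left_Ioi (fun t : ℝ => t ^ (ζ.re - 1) * ‖g t‖) 0 hx
      rw [mul_zero, smul_eq_mul] at h2
      have h3 : ∫ y in Set.Ioi (0 : ℝ), ‖Function.uncurry F (y, x)‖ =
          ∫ y in Set.Ioi (0 : ℝ), (|k x| * h x ^ (1 - ζ.re)) *
            ((h x * y) ^ (ζ.re - 1) * ‖g (h x * y)‖) := by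
        refine setIntegral_congr_fun measurableSet_Ioi fun y hy => ?_
        have hy : 0 < y := hy
        simp only [Function.uncurry, hF, norm_mul, Complex.norm_real, Real.norm_eq_abs,
          Complex.norm_cpow_eq_rpow_re_of_pos hy, Complex.sub_re, Complex.one_re]
        rw [Real.mul_rpow hx.le hy.le]
        have : h x ^ (1 - ζ.re) * h x ^ (ζ.re - 1) = 1 := by
          rw [← Real.rpow_add hx]; simp
        linear_combination (-(|k x| * y ^ (ζ.re - 1) * ‖g (h x * y)‖)) * this
      rw [h3, integral_const_mul, h2, norm_mul, Real.norm_eq_abs, Real.norm_eq_abs,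
        abs_of_pos (Real.rpow_pos_of_pos hx _)]
      have : h x ^ (-ζ.re) = h x ^ (1 - ζ.re) * (h x)⁻¹ := by
        rw [← Real.rpow_neg_one, ← Real.rpow_add hx]; ring_nf
      rw [this]
      ring
  constructor
  · refine hInt.integral_prod_left.congr (ae_of_all _ fun y => ?_)
    simp only [Function.uncurry, hF, integral_const_mul, smul_eq_mul]
  · calc mellin (fun y => ∫ x, (k x : ℂ) * g (h x * y) ∂ν) ζ
        = ∫ y in Set.Ioi (0 : ℝ), ∫ x, F y x ∂ν := by
          simp only [mellin, hF, integral_const_mul, smul_eq_mul]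
      _ = ∫ x, (∫ y in Set.Ioi (0 : ℝ), F y x) ∂ν := integral_integral_swap hInt
      _ = ∫ x, (k x : ℂ) * (h x : ℂ) ^ (-ζ) * mellin g ζ ∂ν := integral_congr_ae hinner
      _ = _ := integral_mul_const _ _

lemma hasMellin_exp_neg {ζ : ℂ} (hζ : 0 < ζ.re) :
    HasMellin (fun t : ℝ => ((Real.exp (-t) : ℝ) : ℂ)) ζ (Complex.Gamma ζ) := by
  refine ⟨?_, ?_⟩
  · refine (Complex.GammaIntegral_convergent hζ).congr (ae_of_all _ fun t => ?_)
    simp only [smul_eq_mul, mul_comm]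
  · rw [Complex.Gamma_eq_integral hζ, Complex.GammaIntegral_eq_mellin]

/-- The Mellin transform of `(1 + y) ^ (-a)`, which is the scale mixture of `exp (-y)` by a gamma
distribution. -/
lemma hasMellin_one_add_rpow_neg {a : ℝ} {ζ : ℂ} (h0 : 0 < ζ.re) (ha : ζ.re < a) :
    HasMellin (fun y : ℝ => (((1 + y) ^ (-a) : ℝ) : ℂ)) ζ
      (Complex.Gamma ζ * Complex.Gamma (a - ζ) / Complex.Gamma a) := by
  have ha0 : 0 < a := h0.trans ha
  have hG : Complex.Gamma a ≠ 0 := Complex.Gamma_ne_zero_of_re_pos (by simpa using ha0)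
  have hmix := hasMellin_integral_comp_mul (ν := volume.restrict (Set.Ioi (0 : ℝ)))
    (k := fun v => v ^ (a - 1) * Real.exp (-v)) (h := fun v => v)
    (g := fun t : ℝ => ((Real.exp (-t) : ℝ) : ℂ)) (ζ := ζ)
    (by fun_prop) measurable_id (by fun_prop) (ae_restrict_mem measurableSet_Ioi)
    (hasMellin_exp_neg h0).1 (by
      refine (Real.GammaIntegral_convergent (s := a - ζ.re) (by linarith)).congr ?_
      filter_upwards [ae_restrict_mem measurableSet_Ioi] with v hv
      have hv : 0 < v := hv
      rw [show a - ζ.re - 1 = (a - 1) + -ζ.re by ring, Real.rpow_add hv]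
      ring)
  have hmoment : ∫ v in Set.Ioi (0 : ℝ), ((v ^ (a - 1) * Real.exp (-v) : ℝ) : ℂ) * (v : ℂ) ^ (-ζ) =
      Complex.Gamma (a - ζ) := by
    rw [Complex.Gamma_eq_integral (by simpa using ha), Complex.GammaIntegral]
    refine setIntegral_congr_fun measurableSet_Ioi fun v hv => ?_
    have hv : 0 < v := hv
    have hv' : (v : ℂ) ≠ 0 := by exact_mod_cast hv.ne'
    simp only [Complex.ofReal_mul, Complex.ofReal_cpow hv.le]
    rw [show (a : ℂ) - ζ - 1 = ((a - 1 : ℝ) : ℂ) + -ζ by push_cast; ring, Complex.cpow_add _ _ hv']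
    ring
  rw [hmoment, (hasMellin_exp_neg h0).2] at hmix
  have hfun : Set.EqOn (fun y : ℝ => ∫ v in Set.Ioi (0 : ℝ),
      ((v ^ (a - 1) * Real.exp (-v) : ℝ) : ℂ) * ((Real.exp (-(v * y)) : ℝ) : ℂ))
      (fun y => Complex.Gamma a * (((1 + y) ^ (-a) : ℝ) : ℂ)) (Set.Ioi 0) := by
    intro y hy
    have hy : 0 < y := hy
    have h1 := Real.integral_rpow_mul_exp_neg_mul_Ioi ha0 (r := 1 + y) (by linarith)
    simp only [← Complex.ofReal_mul]
    rw [integral_complex_ofReal, Complex.Gamma_ofReal, ← Complex.ofReal_mul]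
    congr 1
    rw [Real.rpow_neg (by linarith), ← Real.inv_rpow (by linarith), ← one_div, mul_comm, ← h1]
    refine setIntegral_congr_fun measurableSet_Ioi fun v _ => ?_
    simp only [mul_assoc, ← Real.exp_add]
    congr 2
    ring
  constructor
  · have h1 : IntegrableOn (fun y : ℝ => (Complex.Gamma a)⁻¹ * ((y : ℂ) ^ (ζ - 1) •
        (Complex.Gamma a * (((1 + y) ^ (-a) : ℝ) : ℂ)))) (Set.Ioi 0) := by
      refine Integrable.const_mul ?_ _
      refine IntegrableOn.congr_fun hmix.1 (fun y hy => ?_) measurableSet_Ioi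
      have h := hfun hy
      simp only at h ⊢
      rw [h]
    refine h1.congr (ae_of_all _ fun y => ?_)
    simp only [smul_eq_mul]
    field_simp
  · rw [eq_div_iff hG, mul_comm (Complex.Gamma ζ), ← hmix.2, mellin, mellin, mul_comm,
      ← integral_const_mul]
    refine setIntegral_congr_fun measurableSet_Ioi fun y hy => ?_
    simp only [hfun hy, smul_eq_mul]
    ring

/-- The moments of `-log` on the unit interval: the derivative of `∫ z ^ (s - 1) = 1 / s`. -/
lemma integral_neg_log_mul_cpow {s : ℂ} (hs : 0 < s.re) :
    IntegrableOn (fun z : ℝ => ((-Real.log z : ℝ) : ℂ) * (z : ℂ) ^ (s - 1)) (Set.Ioo 0 1) ∧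
      ∫ z in Set.Ioo (0 : ℝ) 1, ((-Real.log z : ℝ) : ℂ) * (z : ℂ) ^ (s - 1) = 1 / s ^ 2 := by
  have hs0 : s ≠ 0 := by rintro rfl; simp at hs
  set f : ℝ → ℂ := Set.indicator (Set.Ioc 0 1) (fun _ => 1) with hf
  obtain ⟨hc, hd⟩ := mellin_hasDerivAt_of_isBigO_rpow (a := s.re + 1) (b := 0) (f := f) (s := s)
    (by
      refine (Integrable.locallyIntegrable ?_).locallyIntegrableOn _
      rw [hf, integrable_indicator_iff measurableSet_Ioc]
      exact integrableOn_const (by simp))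
    (by
      refine Asymptotics.IsBigO.of_bound 0 ?_
      filter_upwards [eventually_gt_atTop 1] with t ht
      simp [hf, ht])
    (by linarith)
    (by
      refine Asymptotics.IsBigO.of_bound 1 (Eventually.of_forall fun t => ?_)
      simp only [hf, neg_zero, Real.rpow_zero, norm_one, mul_one]
      exact (norm_indicator_le_norm_self _ _).trans (by simp))
    hs
  have hd' : HasDerivAt (mellin f) (-(s ^ 2)⁻¹) s := by
    refine (hasDerivAt_inv hs0).congr_of_eventuallyEq ?_
    filter_upwards [(Complex.continuous_re.isOpen_preimage _ isOpen_Ioi).mem_nhds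
      (show s ∈ Complex.re ⁻¹' Set.Ioi 0 from hs)] with w hw
    rw [hf, (hasMellin_one_Ioc hw).2, one_div]
  have hval := hd.unique hd'
  have hind : ∀ t : ℝ, (t : ℂ) ^ (s - 1) • (Real.log t • f t) =
      (Set.Ioc (0 : ℝ) 1).indicator
        (fun z : ℝ => -(((-Real.log z : ℝ) : ℂ) * (z : ℂ) ^ (s - 1))) t := by
    intro t
    by_cases ht : t ∈ Set.Ioc (0 : ℝ) 1
    · simp only [hf, Set.indicator_of_mem ht, smul_eq_mul, Complex.real_smul]
      push_cast
      ring
    · simp [hf, Set.indicator_of_notMem ht]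
  have hsub : Set.Ioc (0 : ℝ) 1 ⊆ Set.Ioi 0 := Set.Ioc_subset_Ioi_self
  rw [MellinConvergent] at hc
  rw [mellin] at hval
  simp only [hind] at hc hval
  rw [IntegrableOn, integrable_indicator_iff measurableSet_Ioc, IntegrableOn,
    Measure.restrict_restrict measurableSet_Ioc, Set.inter_eq_left.mpr hsub] at hc
  rw [integral_indicator measurableSet_Ioc,
    Measure.restrict_restrict measurableSet_Ioc, Set.inter_eq_left.mpr hsub, integral_neg,
    neg_inj, integral_Ioc_eq_integral_Ioo] at hval
  refine ⟨?_, by rw [hval, one_div]⟩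
  have := hc.neg.mono_measure (Measure.restrict_mono Set.Ioo_subset_Ioc_self le_rfl)
  simpa [IntegrableOn, Pi.neg_def] using this

/-! ### The `H`-function of the density -/

lemma norm_Gamma_le {ζ : ℂ} (hζ : 0 < ζ.re) : ‖Complex.Gamma ζ‖ ≤ Real.Gamma ζ.re := by
  rw [Complex.Gamma_eq_integral hζ, Complex.GammaIntegral, Real.Gamma_eq_integral hζ]
  refine (norm_integral_le_integral_norm _).trans_eq
    (setIntegral_congr_fun measurableSet_Ioi fun x hx => ?_)
  simp only [norm_mul, Complex.norm_real, Complex.norm_cpow_eq_rpow_re_of_pos hx]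
  simp

/-- The kernel `Γ(ζ) Γ(a - ζ) / (q + α ζ) ^ 2`. With `a = μ + m` and `q = β - α μ` it is the
Mellin–Barnes kernel of the H-function in the density, after the cancellation of its two quotients
`Γ(q + α ζ) / Γ(1 + q + α ζ)`. -/
noncomputable def mbKernel (α a q : ℝ) (ζ : ℂ) : ℂ :=
  Complex.Gamma ζ * Complex.Gamma (a - ζ) * (1 / (q + α * ζ) ^ 2)

/-- The mixture of the functions `y ↦ (1 + y z ^ (-α / 2)) ^ (-a)` against
`-log z * z ^ (q / 2 - 1)` on the unit interval. -/
noncomputable def logMixture (α a q y : ℝ) : ℝ :=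
  ∫ z in Set.Ioo (0 : ℝ) 1, -Real.log z * z ^ (q / 2 - 1) * (1 + z ^ (-α / 2) * y) ^ (-a)

lemma re_line (c t : ℝ) : ((c : ℂ) + t * Complex.I).re = c := by simp

lemma integrable_inv_sq_line {α q c : ℝ} (hα : 0 < α) (hq : 0 < q + α * c) :
    Integrable (fun t : ℝ => ‖(1 : ℂ) / (q + α * (c + t * Complex.I)) ^ 2‖) := by
  set r := q + α * c
  have hnorm : ∀ t : ℝ, ‖(1 : ℂ) / (q + α * (c + t * Complex.I)) ^ 2‖ =
      (r ^ 2)⁻¹ * (1 + (α / r * t) ^ 2)⁻¹ := by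
    intro t
    have h : (q : ℂ) + α * (c + t * Complex.I) = (r : ℂ) + ((α * t : ℝ) : ℂ) * Complex.I := by
      simp only [r]; push_cast; ring
    rw [norm_div, norm_one, norm_pow, Complex.sq_norm, h, Complex.normSq_add_mul_I, one_div,
      ← mul_inv]
    congr 1
    field_simp
  simp_rw [hnorm]
  exact (integrable_inv_one_add_sq.comp_mul_left' (div_pos hα hq).ne').const_mul _

lemma norm_mbKernel_le {α a q c : ℝ} (hc : 0 < c) (hca : c < a) (t : ℝ) :
    ‖mbKernel α a q (c + t * Complex.I)‖ ≤ Real.Gamma c * Real.Gamma (a - c) *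
      ‖(1 : ℂ) / (q + α * (c + t * Complex.I)) ^ 2‖ := by
  have h1 := norm_Gamma_le (ζ := c + t * Complex.I) (by simpa using hc)
  have h2 := norm_Gamma_le (ζ := a - (c + t * Complex.I)) (by simpa using hca)
  simp only [re_line, Complex.sub_re, Complex.ofReal_re] at h1 h2
  rw [mbKernel, norm_mul, norm_mul]
  gcongr

lemma continuous_Gamma_comp {f : ℝ → ℂ} (hf : Continuous f) (hpos : ∀ t, 0 < (f t).re) :
    Continuous fun t => Complex.Gamma (f t) := by
  refine continuous_iff_continuousAt.mpr fun t => ?_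
  refine ContinuousAt.comp (f := f) (Complex.differentiableAt_Gamma _ fun n h => ?_).continuousAt
    hf.continuousAt
  have := hpos t
  rw [h] at this
  simp only [Complex.neg_re, Complex.natCast_re] at this
  linarith [n.cast_nonneg (α := ℝ)]

lemma integrable_mbKernel {α a q c : ℝ} (hα : 0 < α) (hc : 0 < c) (hca : c < a)
    (hq : 0 < q + α * c) : Integrable fun t : ℝ => mbKernel α a q (c + t * Complex.I) := by
  refine Integrable.mono' ((integrable_inv_sq_line hα hq).const_mul _) ?_
    (ae_of_all _ (norm_mbKernel_le hc hca))
  unfold mbKernel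
  refine ((Continuous.aestronglyMeasurable ?_).mul (Continuous.aestronglyMeasurable ?_)).mul
    (Measurable.aestronglyMeasurable (by fun_prop))
  · exact continuous_Gamma_comp (by fun_prop) fun t => by simpa using hc
  · exact continuous_Gamma_comp (by fun_prop) fun t => by simpa using hca

/-- The moment of the mixing density of `logMixture` that enters its Mellin transform. -/
lemma integral_neg_log_mul_rpow_mul_cpow {α q : ℝ} {ζ : ℂ} (h : 0 < q + α * ζ.re) :
    IntegrableOn (fun z : ℝ => ((-Real.log z * z ^ (q / 2 - 1) : ℝ) : ℂ) *
        ((z ^ (-α / 2) : ℝ) : ℂ) ^ (-ζ)) (Set.Ioo 0 1) ∧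
      ∫ z in Set.Ioo (0 : ℝ) 1, ((-Real.log z * z ^ (q / 2 - 1) : ℝ) : ℂ) *
        ((z ^ (-α / 2) : ℝ) : ℂ) ^ (-ζ) = 4 * (1 / (q + α * ζ) ^ 2) := by
  have hre : 0 < ((q + α * ζ) / 2 : ℂ).re := by
    have : ((q + α * ζ) / 2 : ℂ).re = (q + α * ζ.re) / 2 := by simp
    rw [this]; linarith
  obtain ⟨h1, h2⟩ := integral_neg_log_mul_cpow hre
  have heq : Set.EqOn (fun z : ℝ => ((-Real.log z : ℝ) : ℂ) * (z : ℂ) ^ ((q + α * ζ) / 2 - 1 : ℂ))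
      (fun z : ℝ => ((-Real.log z * z ^ (q / 2 - 1) : ℝ) : ℂ) *
        ((z ^ (-α / 2) : ℝ) : ℂ) ^ (-ζ)) (Set.Ioo 0 1) := by
    intro z hz
    have hz0 : (z : ℂ) ≠ 0 := by exact_mod_cast hz.1.ne'
    simp only [Complex.ofReal_mul]
    rw [Complex.ofReal_cpow hz.1.le, Complex.ofReal_cpow hz.1.le,
      ← Complex.ofReal_cpow hz.1.le (-α / 2), ← Complex.cpow_mul_ofReal_nonneg hz.1.le, mul_assoc, ← Complex.cpow_add _ _ hz0]
    congr 2
    push_cast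
    ring
  refine ⟨h1.congr_fun heq measurableSet_Ioo, ?_⟩
  rw [← setIntegral_congr_fun measurableSet_Ioo heq, h2]
  by_cases h0 : (q + α * ζ : ℂ) = 0
  · simp [h0]
  · field_simp; norm_num

/-- The Mellin transform of `logMixture` is the kernel `mbKernel`, up to a constant. -/
lemma hasMellin_logMixture {α a q : ℝ} {ζ : ℂ} (h0 : 0 < ζ.re) (ha : ζ.re < a)
    (h : 0 < q + α * ζ.re) :
    HasMellin (fun y => (logMixture α a q y : ℂ)) ζ
      (4 / Complex.Gamma a * mbKernel α a q ζ) := by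
  have hg := hasMellin_one_add_rpow_neg h0 ha
  have hmix := hasMellin_integral_comp_mul (ν := volume.restrict (Set.Ioo (0 : ℝ) 1))
    (k := fun z => -Real.log z * z ^ (q / 2 - 1)) (h := fun z => z ^ (-α / 2))
    (by fun_prop) (by fun_prop) (by fun_prop)
    (by
      filter_upwards [ae_restrict_mem measurableSet_Ioo] with z hz
      exact Real.rpow_pos_of_pos hz.1 _) hg.1
    (by
      refine (integral_neg_log_mul_rpow_mul_cpow (ζ := (ζ.re : ℂ)) (by simpa using h)).1.re.congr ?_
      filter_upwards [ae_restrict_mem measurableSet_Ioo] with z hz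
      rw [← Complex.ofReal_neg, ← Complex.ofReal_cpow (Real.rpow_nonneg hz.1.le _),
        ← Complex.ofReal_mul]
      simp)
  rw [hg.2, (integral_neg_log_mul_rpow_mul_cpow h).2] at hmix
  convert hmix using 1
  · funext y
    simp only [← Complex.ofReal_mul]
    rw [integral_complex_ofReal]
    rfl
  · rw [mbKernel]
    ring

lemma one_add_rpow_neg_le {u a c : ℝ} (hu : 0 < u) (hc : 0 < c) (hca : c < a) :
    (1 + u) ^ (-a) ≤ u ^ (-c) :=
  (Real.rpow_le_rpow_of_exponent_le (by linarith) (by linarith)).trans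
    (Real.rpow_le_rpow_of_nonpos hu (by linarith) (by linarith))

lemma continuousAt_logMixture {α a q c y₀ : ℝ} (hc : 0 < c) (hca : c < a) (h : 0 < q + α * c)
    (hy₀ : 0 < y₀) : ContinuousAt (logMixture α a q) y₀ := by
  have hnear : ∀ᶠ y in 𝓝 y₀, y₀ / 2 < y := lt_mem_nhds (by linarith)
  unfold logMixture
  refine continuousAt_of_dominated (bound := fun z => -Real.log z * z ^ (q / 2 - 1) *
    (z ^ (-α / 2)) ^ (-c) * (y₀ / 2) ^ (-c)) (Eventually.of_forall fun y =>
      Measurable.aestronglyMeasurable (by fun_prop)) ?_ ?_ ?_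
  · filter_upwards [hnear] with y hy
    filter_upwards [ae_restrict_mem measurableSet_Ioo] with z hz
    have hz' : 0 < z ^ (-α / 2) := Real.rpow_pos_of_pos hz.1 _
    have hk : 0 ≤ -Real.log z * z ^ (q / 2 - 1) :=
      mul_nonneg (neg_nonneg.mpr (Real.log_nonpos hz.1.le hz.2.le)) (Real.rpow_nonneg hz.1.le _)
    have hy' : 0 < y := by linarith
    rw [norm_mul, Real.norm_of_nonneg hk, Real.norm_of_nonneg (by positivity), mul_assoc (_ * _),
      ← Real.mul_rpow hz'.le (by positivity)]
    refine mul_le_mul_of_nonneg_left ((one_add_rpow_neg_le (mul_pos hz' hy') hc hca).trans ?_) hk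
    exact Real.rpow_le_rpow_of_nonpos (by positivity) (by gcongr) (by linarith)
  · refine Integrable.mul_const ?_ _
    refine (integral_neg_log_mul_rpow_mul_cpow (ζ := (c : ℂ)) (by simpa using h)).1.re.congr ?_
    filter_upwards [ae_restrict_mem measurableSet_Ioo] with z hz
    rw [← Complex.ofReal_neg, ← Complex.ofReal_cpow (Real.rpow_nonneg hz.1.le _),
      ← Complex.ofReal_mul]
    simp
  · filter_upwards [ae_restrict_mem measurableSet_Ioo] with z hz
    have hz' : 0 < z ^ (-α / 2) := Real.rpow_pos_of_pos hz.1 _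
    refine ContinuousAt.mul continuousAt_const (ContinuousAt.rpow_const (by fun_prop) (Or.inl ?_))
    positivity

/-- The Mellin–Barnes integral of `mbKernel` along any separating line is the Mellin inversion
integral of `logMixture`; in particular it does not depend on the line. -/
lemma mellinBarnes_eq_logMixture {α a q c y : ℝ} (hα : 0 < α) (hc : 0 < c) (hca : c < a)
    (h : 0 < q + α * c) (hy : 0 < y) :
    (1 / (2 * Real.pi) : ℂ) * ∫ t : ℝ, mbKernel α a q (c + t * Complex.I) *
        Complex.exp (-(c + t * Complex.I) * (Real.log y : ℝ)) =
      Complex.Gamma a / 4 * logMixture α a q y := by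
  have hG : Complex.Gamma a ≠ 0 := Complex.Gamma_ne_zero_of_re_pos (by simpa using hc.trans hca)
  have hM : ∀ t : ℝ, mellin (fun y => (logMixture α a q y : ℂ)) (c + t * Complex.I) =
      4 / Complex.Gamma a * mbKernel α a q (c + t * Complex.I) := fun t =>
    (hasMellin_logMixture (by simpa using hc) (by simpa using hca) (by simpa using h)).2
  have hinv := mellinInv_mellin_eq c (fun y => (logMixture α a q y : ℂ)) hy
    (hasMellin_logMixture (by simpa using hc) (by simpa using hca) (by simpa using h)).1
    (by
      unfold Complex.VerticalIntegrable
      simp_rw [hM]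
      exact (integrable_mbKernel hα hc hca h).const_mul _)
    (Complex.continuous_ofReal.continuousAt.comp (continuousAt_logMixture hc hca h hy))
  rw [← hinv, mellinInv]
  simp_rw [hM, smul_eq_mul, Complex.cpow_def_of_ne_zero (Complex.ofReal_ne_zero.mpr hy.ne')]
  rw [Complex.real_smul, mul_left_comm, ← integral_const_mul (Complex.Gamma a / 4)]
  push_cast
  congr 2
  funext t
  rw [Complex.ofReal_log hy.le]
  field_simp

/-! ### Laplace transforms of powers -/

lemma integrableOn_rpow_mul_exp_neg_mul {p r : ℝ} (hp : -1 < p) (hr : 0 < r) :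
    IntegrableOn (fun t : ℝ => t ^ p * Real.exp (-(r * t))) (Set.Ioi 0) := by
  simpa using integrableOn_rpow_mul_exp_neg_mul_rpow hp one_pos hr

lemma norm_cpow_mul_exp_neg_mul {a r : ℂ} {t : ℝ} (ht : 0 < t) :
    ‖(t : ℂ) ^ (a - 1) * Complex.exp (-(r * t))‖ = t ^ (a.re - 1) * Real.exp (-(r.re * t)) := by
  rw [norm_mul, Complex.norm_cpow_eq_rpow_re_of_pos ht, Complex.norm_exp]
  simp

lemma integrableOn_cpow_mul_exp_neg_mul {a r : ℂ} (ha : 0 < a.re) (hr : 0 < r.re) :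
    IntegrableOn (fun t : ℝ => (t : ℂ) ^ (a - 1) * Complex.exp (-(r * t))) (Set.Ioi 0) := by
  refine Integrable.mono' (integrableOn_rpow_mul_exp_neg_mul (p := a.re - 1) (by linarith) hr)
    (Measurable.aestronglyMeasurable (by fun_prop)) ?_
  filter_upwards [ae_restrict_mem measurableSet_Ioi] with t ht
  exact (norm_cpow_mul_exp_neg_mul ht).le

/-- `∫ t ^ (a - 1) exp (-r t) = Γ(a) r ^ (-a)` on the right half-plane, by analytic continuation
from real `r`. -/
lemma integral_cpow_mul_exp_neg_mul {a r : ℂ} (ha : 0 < a.re) (hr : 0 < r.re) :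
    ∫ t in Set.Ioi (0 : ℝ), (t : ℂ) ^ (a - 1) * Complex.exp (-(r * t)) =
      Complex.Gamma a * Complex.exp (-a * Complex.log r) := by
  set U : Set ℂ := {r | 0 < r.re} with hU
  have hUo : IsOpen U := isOpen_lt continuous_const Complex.continuous_re
  have hUc : IsPreconnected U := (convex_halfSpace_re_gt 0).isPreconnected
  have hf : DifferentiableOn ℂ (fun r : ℂ => ∫ t in Set.Ioi (0 : ℝ),
      (t : ℂ) ^ (a - 1) * Complex.exp (-(r * t))) U := by
    intro r₀ hr₀
    have hr₀ : 0 < r₀.re := hr₀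
    refine DifferentiableAt.differentiableWithinAt (HasDerivAt.differentiableAt
      (hasDerivAt_integral_of_dominated_loc_of_deriv_le
        (F := fun (r : ℂ) (t : ℝ) => (t : ℂ) ^ (a - 1) * Complex.exp (-(r * t)))
        (F' := fun r t => (t : ℂ) ^ (a - 1) * (Complex.exp (-(r * t)) * (-(1 * t))))
        (bound := fun t => t ^ a.re * Real.exp (-(r₀.re / 2 * t)))
        (Metric.ball_mem_nhds r₀ (half_pos hr₀))
        (Eventually.of_forall fun r => Measurable.aestronglyMeasurable (by fun_prop))
        (integrableOn_cpow_mul_exp_neg_mul ha hr₀)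
        (Measurable.aestronglyMeasurable (by fun_prop)) ?_
        (integrableOn_rpow_mul_exp_neg_mul (by linarith) (half_pos hr₀)) ?_).2)
    · filter_upwards [ae_restrict_mem measurableSet_Ioi] with t ht r hrb
      have ht : 0 < t := ht
      have hre : r₀.re / 2 ≤ r.re := by
        rw [Metric.mem_ball, dist_eq_norm] at hrb
        have := (Complex.abs_re_le_norm (r - r₀)).trans_lt hrb
        rw [Complex.sub_re, abs_lt] at this
        linarith [this.1]
      rw [← mul_assoc, norm_mul, norm_cpow_mul_exp_neg_mul ht]
      have h1 : ‖-(1 * (t : ℂ))‖ = t := by simp [abs_of_pos ht]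
      have h2 : t ^ a.re = t ^ (a.re - 1) * t := by
        rw [← Real.rpow_add_one ht.ne']; ring_nf
      rw [h1, h2, mul_right_comm]
      gcongr
    · refine ae_of_all _ fun t r _ => ?_
      exact ((((hasDerivAt_id r).mul_const (t : ℂ)).neg).cexp).const_mul _
  have hg : DifferentiableOn ℂ (fun r : ℂ => Complex.Gamma a * Complex.exp (-a * Complex.log r))
      U := by
    intro r₀ hr₀
    refine DifferentiableAt.differentiableWithinAt ?_
    exact (((Complex.differentiableAt_log (Or.inl hr₀)).const_mul _).cexp).const_mul _
  have hfreq : ∃ᶠ r in 𝓝[≠] (1 : ℂ), (fun r : ℂ => ∫ t in Set.Ioi (0 : ℝ),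
      (t : ℂ) ^ (a - 1) * Complex.exp (-(r * t))) r =
      (fun r : ℂ => Complex.Gamma a * Complex.exp (-a * Complex.log r)) r := by
    have htend : Tendsto (fun x : ℝ => (x : ℂ)) (𝓝[≠] 1) (𝓝[≠] 1) := by
      refine tendsto_nhdsWithin_iff.mpr ⟨?_, ?_⟩
      · exact ((Complex.continuous_ofReal.tendsto 1).mono_left nhdsWithin_le_nhds)
      · filter_upwards [self_mem_nhdsWithin] with x hx
        simpa using hx
    refine htend.frequently (Eventually.frequently ?_)
    have hpos : ∀ᶠ x : ℝ in 𝓝[≠] 1, 0 < x :=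
      nhdsWithin_le_nhds (lt_mem_nhds one_pos)
    filter_upwards [hpos] with x hx
    have hx' : (1 / x : ℂ) = ((1 / x : ℝ) : ℂ) := by push_cast; rfl
    rw [Complex.integral_cpow_mul_exp_neg_mul_Ioi ha hx, mul_comm, hx',
      Complex.cpow_def_of_ne_zero (by exact_mod_cast (one_div_pos.mpr hx).ne'),
      ← Complex.ofReal_log (one_div_pos.mpr hx).le, ← Complex.ofReal_log hx.le, one_div,
      Real.log_inv]
    push_cast
    ring_nf
  exact (hf.analyticOnNhd hUo).eqOn_of_preconnected_of_frequently_eq (hg.analyticOnNhd hUo) hUc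
    (show (1 : ℂ) ∈ U by simp [hU]) hfreq hr

/-! ### The two Fox H-functions -/

/-- The H-function in the density, as a function of the logarithm of its argument. -/
noncomputable def densityH (α μ β m : ℝ) (L : ℂ) : ℂ :=
  foxH 3 1
    ![(1 - μ - m, 1), (1 + β - α * μ, α), (1 + β - α * μ, α)]
    ![(0, 1), (β - α * μ, α), (β - α * μ, α)] L

/-- The H-function in the moment generating function, as a function of the logarithm of its
argument. -/
noncomputable def mgfH (α μ β m : ℝ) (L : ℂ) : ℂ :=
  foxH 3 2
    ![(1, α / 2), (1 - m, 1), (1 + β, α), (1 + β, α)]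
    ![(μ, 1), (β, α), (β, α)] L

lemma foxHSeparates_density_iff {α μ β m c : ℝ} :
    FoxHSeparates 3 1
      ![((1 - μ - m : ℂ), (1 : ℝ)), (1 + β - α * μ, α), (1 + β - α * μ, α)]
      ![(0, 1), (β - α * μ, α), (β - α * μ, α)] c ↔
      0 < c ∧ c < μ + m ∧ 0 < β - α * μ + α * c := by
  simp only [FoxHSeparates, Fin.forall_fin_succ]
  simp
  constructor
  · rintro ⟨⟨h1, h2⟩, h3⟩
    exact ⟨h1, by linarith, h2⟩
  · rintro ⟨h1, h2, h3⟩
    exact ⟨⟨h1, h3⟩, by linarith⟩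

lemma Gamma_div_Gamma_one_add {x : ℂ} (hx : 0 < x.re) :
    Complex.Gamma x * (Complex.Gamma (1 + x))⁻¹ = 1 / x := by
  have h0 : x ≠ 0 := by rintro rfl; simp at hx
  have hG := Complex.Gamma_ne_zero_of_re_pos hx
  rw [add_comm, Complex.Gamma_add_one x h0]
  field_simp

lemma foxHKernel_density {α μ β m : ℝ} {ζ : ℂ} (h : 0 < β - α * μ + α * ζ.re) :
    foxHKernel 3 1
      ![((1 - μ - m : ℂ), (1 : ℝ)), (1 + β - α * μ, α), (1 + β - α * μ, α)]
      ![(0, 1), (β - α * μ, α), (β - α * μ, α)] ζ = mbKernel α (μ + m) (β - α * μ) ζ := by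
  have hG := Gamma_div_Gamma_one_add (x := β - α * μ + α * ζ) (by simpa using h)
  simp only [foxHKernel, Fin.prod_univ_three, mbKernel]
  simp
  rw [show (1 : ℂ) + β - α * μ + α * ζ = 1 + (β - α * μ + α * ζ) by ring,
    show (1 : ℂ) - (1 - μ - m) - ζ = μ + m - ζ by ring]
  rw [one_div] at hG
  rw [← inv_pow, ← hG]
  ring

/-- Whichever separating line the definition of the H-function picks, its value is `logMixture`. -/
lemma foxH_density_eq {α μ β m y : ℝ} (hα : 0 < α) (hμ : 0 < μ) (hβ : 0 < β) (hm : 0 < m)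
    (hy : 0 < y) :
    densityH α μ β m (Real.log y : ℝ) =
      Complex.Gamma (μ + m) / 4 * logMixture α (μ + m) (β - α * μ) y := by
  have hex : ∃ c : ℝ, FoxHSeparates 3 1
      ![((1 - μ - m : ℂ), (1 : ℝ)), (1 + β - α * μ, α), (1 + β - α * μ, α)]
      ![(0, 1), (β - α * μ, α), (β - α * μ, α)] c := by
    refine ⟨μ, foxHSeparates_density_iff.mpr ⟨hμ, by linarith, by linarith⟩⟩
  rw [densityH, foxH, dif_pos hex]
  obtain ⟨h1, h2, h3⟩ := foxHSeparates_density_iff.mp hex.choose_spec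
  have key := mellinBarnes_eq_logMixture hα h1 h2 h3 hy
  push_cast at key
  rw [← key, foxHLineIntegral]
  congr 2
  funext t
  rw [foxHKernel_density (by simpa using h3)]

lemma foxHSeparates_mgf_iff {α μ β m c : ℝ} (hα : 0 < α) (hm : 0 < m) :
    FoxHSeparates 3 2
      ![((1 : ℂ), (α / 2 : ℝ)), (1 - m, 1), (1 + β, α), (1 + β, α)]
      ![((μ : ℂ), (1 : ℝ)), (β, α), (β, α)] c ↔
      0 < μ + c ∧ 0 < β + α * c ∧ c < 0 := by
  simp only [FoxHSeparates, Fin.forall_fin_succ]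
  simp
  constructor
  · rintro ⟨⟨h1, h2⟩, h3, h4⟩
    exact ⟨h1, h2, by nlinarith⟩
  · rintro ⟨h1, h2, h3⟩
    exact ⟨⟨h1, h2⟩, by nlinarith, by linarith⟩

/-- The kernel of the moment generating function is that of the density, shifted by `μ`, times the
Gamma factor produced by the Laplace transform. -/
lemma foxHKernel_mgf {α μ β m : ℝ} {ζ : ℂ} (h : 0 < β + α * ζ.re) :
    foxHKernel 3 2
      ![((1 : ℂ), (α / 2 : ℝ)), (1 - m, 1), (1 + β, α), (1 + β, α)]
      ![((μ : ℂ), (1 : ℝ)), (β, α), (β, α)] ζ =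
      Complex.Gamma (-(α / 2 * ζ)) * mbKernel α (μ + m) (β - α * μ) (μ + ζ) := by
  have hG := Gamma_div_Gamma_one_add (x := β + α * ζ) (by simpa using h)
  simp only [foxHKernel, Fin.prod_univ_three, Fin.prod_univ_four, mbKernel]
  simp
  rw [show (1 : ℂ) + β + α * ζ = 1 + (β + α * ζ) by ring,
    show (β : ℂ) - α * μ + α * (μ + ζ) = β + α * ζ by ring]
  rw [one_div] at hG
  rw [← inv_pow, ← hG]
  ring

/-- The Laplace transform of a power times the density H-function. The line of integration of the
moment generating function, shifted by `μ`, is a separating line of the density on which Fubini's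
theorem applies. -/
lemma laplace_densityH {α μ β m ℓ : ℝ} {S : ℂ} (hα : 0 < α) (hμ : 0 < μ) (hβ : 0 < β) (hm : 0 < m)
    (hS : 0 < S.re) :
    IntegrableOn (fun y : ℝ => ((y ^ (α * μ / 2 - 1) : ℝ) : ℂ) *
        densityH α μ β m ((ℓ + α / 2 * Real.log y : ℝ) : ℂ) * Complex.exp (-S * y)) (Set.Ioi 0) ∧
      ∫ y in Set.Ioi (0 : ℝ), ((y ^ (α * μ / 2 - 1) : ℝ) : ℂ) *
        densityH α μ β m ((ℓ + α / 2 * Real.log y : ℝ) : ℂ) * Complex.exp (-S * y) =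
      ((Real.exp (-(μ * ℓ)) : ℝ) : ℂ) * mgfH α μ β m (ℓ - α / 2 * Complex.log S) := by
  have hex : ∃ c : ℝ, FoxHSeparates 3 2
      ![((1 : ℂ), (α / 2 : ℝ)), (1 - m, 1), (1 + β, α), (1 + β, α)]
      ![((μ : ℂ), (1 : ℝ)), (β, α), (β, α)] c := by
    -- The separating lines are those with `max (-μ) (-β / α) < c < 0`.
    refine ⟨-min (μ / 2) (β / (2 * α)), (foxHSeparates_mgf_iff hα hm).mpr ⟨?_, ?_, ?_⟩⟩
    · linarith [min_le_left (μ / 2) (β / (2 * α))]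
    · have h1 := min_le_right (μ / 2) (β / (2 * α))
      have h2 : α * (β / (2 * α)) = β / 2 := by field_simp
      nlinarith
    · have := lt_min (half_pos hμ) (show 0 < β / (2 * α) by positivity)
      linarith
  obtain ⟨h1, h2, h3⟩ := (foxHSeparates_mgf_iff hα hm).mp hex.choose_spec
  have hmgf : ∀ L, mgfH α μ β m L = foxHLineIntegral 3 2
      ![((1 : ℂ), (α / 2 : ℝ)), (1 - m, 1), (1 + β, α), (1 + β, α)]
      ![((μ : ℂ), (1 : ℝ)), (β, α), (β, α)] L hex.choose := fun L => by
    rw [mgfH, foxH, dif_pos hex]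
  set c := hex.choose
  set mb : ℝ → ℂ := fun t => mbKernel α (μ + m) (β - α * μ) (((μ + c : ℝ) : ℂ) + t * Complex.I)
    with hmb
  have hsep : 0 < β - α * μ + α * (μ + c) := by linarith
  have hmbint : Integrable mb := by
    have := integrable_mbKernel (a := μ + m) (q := β - α * μ) hα h1 (by linarith) hsep
    push_cast at this
    simpa [hmb] using this
  -- The value of the density H-function does not depend on the line, so that the line `Re ζ = μ + c`
  -- may be used although its definition may have chosen another one.
  have hH : ∀ y : ℝ, 0 < y → densityH α μ β m ((ℓ + α / 2 * Real.log y : ℝ) : ℂ) =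
      (1 / (2 * Real.pi) : ℂ) * ∫ t : ℝ, mb t *
        Complex.exp (-(((μ + c : ℝ) : ℂ) + t * Complex.I) * (ℓ + α / 2 * Real.log y : ℝ)) := by
    intro y hy
    have hlog : Real.log (Real.exp ℓ * y ^ (α / 2)) = ℓ + α / 2 * Real.log y := by
      rw [Real.log_mul (Real.exp_pos _).ne' (Real.rpow_pos_of_pos hy _).ne', Real.log_exp,
        Real.log_rpow hy]
    have hpos : 0 < Real.exp ℓ * y ^ (α / 2) := by positivity
    have hk := mellinBarnes_eq_logMixture (a := μ + m) (q := β - α * μ) hα h1 (by linarith) hsep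
      hpos
    rw [← hlog, foxH_density_eq hα hμ hβ hm hpos, ← Complex.ofReal_add, ← hk]
  set F : ℝ → ℝ → ℂ := fun y t => (1 / (2 * Real.pi) : ℂ) * (mb t *
      Complex.exp (-(((μ + c : ℝ) : ℂ) + t * Complex.I) * ℓ)) *
      ((y : ℂ) ^ (-(α / 2 * (c + t * Complex.I)) - 1) * Complex.exp (-(S * y))) with hF
  have hpoint : Set.EqOn (fun y : ℝ => ((y ^ (α * μ / 2 - 1) : ℝ) : ℂ) *
        densityH α μ β m ((ℓ + α / 2 * Real.log y : ℝ) : ℂ) * Complex.exp (-S * y))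
      (fun y => ∫ t, F y t) (Set.Ioi 0) := by
    intro y hy
    have hy : 0 < y := hy
    have hy0 : (y : ℂ) ≠ 0 := by exact_mod_cast hy.ne'
    simp only
    rw [hH y hy, mul_left_comm, mul_assoc, ← integral_const_mul, ← integral_mul_const,
      ← integral_const_mul]
    refine integral_congr_ae (ae_of_all _ fun t => ?_)
    simp only [hF]
    rw [Complex.ofReal_cpow hy.le, Complex.cpow_def_of_ne_zero hy0, Complex.cpow_def_of_ne_zero hy0,
      ← Complex.ofReal_log hy.le]
    have hexp : Complex.exp (Real.log y * ((α * μ / 2 - 1 : ℝ) : ℂ)) *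
        Complex.exp (-(((μ + c : ℝ) : ℂ) + t * Complex.I) * (ℓ + α / 2 * Real.log y : ℝ)) =
        Complex.exp (-(((μ + c : ℝ) : ℂ) + t * Complex.I) * ℓ) *
        Complex.exp (Real.log y * (-(α / 2 * (c + t * Complex.I)) - 1)) := by
      rw [← Complex.exp_add, ← Complex.exp_add]
      congr 1
      push_cast
      ring
    rw [← neg_mul S]
    linear_combination (1 / (2 * Real.pi) : ℂ) * mb t * Complex.exp (-S * y) * hexp
  have hre : ∀ t : ℝ, (-(α / 2 * (c + t * Complex.I)) : ℂ).re = -(α / 2 * c) := by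
    intro t; simp
  have hpos : 0 < -(α / 2 * c) := by nlinarith
  have hInt : Integrable (Function.uncurry F) ((volume.restrict (Set.Ioi 0)).prod volume) := by
    have hA := integrableOn_rpow_mul_exp_neg_mul (p := -(α / 2 * c) - 1) (by linarith) hS
    have hB := hmbint.norm.const_mul (‖(1 / (2 * Real.pi) : ℂ)‖ * Real.exp (-((μ + c) * ℓ)))
    refine Integrable.mono' (hA.mul_prod hB) ?_ ?_
    · have hm1 : AEStronglyMeasurable (fun p : ℝ × ℝ => mb p.2)
          ((volume.restrict (Set.Ioi 0)).prod volume) :=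
        hmbint.aestronglyMeasurable.comp_snd
      refine ((hm1.mul (Measurable.aestronglyMeasurable ?_)).const_mul _).mul
        (Measurable.aestronglyMeasurable ?_)
      · fun_prop
      · fun_prop
    · have hae : ∀ᵐ p : ℝ × ℝ ∂((volume.restrict (Set.Ioi 0)).prod volume), 0 < p.1 :=
        Measure.quasiMeasurePreserving_fst.ae (ae_restrict_mem measurableSet_Ioi)
      filter_upwards [hae] with p hp
      simp only [Function.uncurry, hF]
      rw [norm_mul, norm_cpow_mul_exp_neg_mul hp, hre, norm_mul, norm_mul, Complex.norm_exp]
      have : (-(((μ + c : ℝ) : ℂ) + p.2 * Complex.I) * ℓ).re = -((μ + c) * ℓ) := by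
        simp
        ring
      rw [this]
      apply le_of_eq
      ring
  refine ⟨IntegrableOn.congr_fun hInt.integral_prod_left hpoint.symm measurableSet_Ioi, ?_⟩
  rw [setIntegral_congr_fun measurableSet_Ioi hpoint, integral_integral_swap hInt, hmgf,
    foxHLineIntegral, mul_left_comm, ← integral_const_mul, ← integral_const_mul]
  refine integral_congr_ae (ae_of_all _ fun t => ?_)
  simp only [hF]
  rw [integral_const_mul, integral_cpow_mul_exp_neg_mul (by rw [hre]; exact hpos) hS,
    foxHKernel_mgf (by simpa using h2)]
  have hexp : Complex.exp (-(((μ + c : ℝ) : ℂ) + t * Complex.I) * ℓ) *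
      Complex.exp (-(-(α / 2 * (c + t * Complex.I))) * Complex.log S) =
      ((Real.exp (-(μ * ℓ)) : ℝ) : ℂ) *
      Complex.exp (-(c + t * Complex.I) * (ℓ - α / 2 * Complex.log S)) := by
    rw [Complex.ofReal_exp, ← Complex.exp_add, ← Complex.exp_add]
    congr 1
    push_cast
    ring
  have hmbt : mbKernel α (μ + m) (β - α * μ) (μ + (c + t * Complex.I)) = mb t := by
    simp only [hmb]
    push_cast
    rw [add_assoc]
  rw [hmbt]
  linear_combination (1 / (2 * Real.pi) : ℂ) * mb t *
    Complex.Gamma (-(α / 2 * (c + t * Complex.I))) * hexp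

/-! ### The Laplace transform of the quadrature form of the density -/

lemma c₂_pos {α μ β lam m : ℝ} (hμ : 0 < μ) (hlam : 0 < lam) (hm : 1 < m) (hβ : 0 < β) :
    0 < c₂ α μ β lam m := by
  have h1 : 0 < m - 1 := by linarith
  unfold c₂
  positivity

lemma Phi_pos {x a₁ a₂ a₃ : ℝ} (ha₁ : 0 < a₁) (hx : -1 < x) : 0 < Phi x a₁ a₂ a₃ := by
  have : 0 < a₁ * (x + 1) := mul_pos ha₁ (by linarith)
  unfold Phi
  positivity

lemma Phi₁_div_Phi₂_rpow {α μ δ κ d₀ RM b x : ℝ} (hd₀ : 0 < d₀) (hRM : 0 < RM) (hx : -1 < x) :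
    Phi₁ α μ δ κ d₀ RM b x / Phi₂ α δ κ d₀ RM x ^ μ = (RM / (2 * d₀) * (x + 1)) ^ b := by
  have hu : 0 < RM / (2 * d₀) * (x + 1) := mul_pos (by positivity) (by linarith)
  unfold Phi₁ Phi₂ Phi
  set u := RM / (2 * d₀) * (x + 1)
  rw [Real.mul_rpow (Real.rpow_nonneg hu.le _) (Real.exp_pos _).le, ← Real.rpow_mul hu.le, ← Real.exp_mul,
    Real.rpow_add hu, show α * δ / 2 * μ = α * μ * δ / 2 by ring,
    show α / 2 * κ * d₀ * (u + 1) * μ = α / 2 * κ * μ * d₀ * (u + 1) by ring]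
  have h1 : u ^ (α * μ * δ / 2) ≠ 0 := (Real.rpow_pos_of_pos hu _).ne'
  field_simp

/-- The Laplace transform of the quadrature form of the density, computed node by node: after the
substitution `y = γ / γ₀`, each summand is a multiple of the integrand of `laplace_densityH`. -/
lemma laplace_snrPDF {α μ β lam m δ γ₀ κ d₀ RM : ℝ} {l : ℕ} (B b : Fin l → ℝ)
    (hα : 0 < α) (hμ : 0 < μ) (hlam : 0 < lam) (hγ₀ : 0 < γ₀) (hd₀ : 0 < d₀) (hRM : 0 < RM)
    (hm : 1 < m) (hβ : 0 < β) {s : ℂ} (hs : 0 < s.re) (N : ℕ) :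
    IntegrableOn (fun γ : ℝ =>
        snrPDF α μ β lam m δ γ₀ κ d₀ RM B b N γ * Complex.exp (-s * γ)) (Set.Ioi 0) ∧
      ∫ γ in Set.Ioi (0 : ℝ),
        snrPDF α μ β lam m δ γ₀ κ d₀ RM B b N γ * Complex.exp (-s * γ) =
          snrMGF α μ β lam m δ γ₀ κ d₀ RM B b N s := by
  have hc₂ := c₂_pos (α := α) hμ hlam hm hβ
  set c := c₂ α μ β lam m with hc
  have hS : 0 < (s * γ₀).re := by simpa using mul_pos hs hγ₀
  set ℓ : ℝ → ℝ := fun x => Real.log (Phi₂ α δ κ d₀ RM x / c) with hℓ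
  set G : ℝ → ℝ → ℂ := fun x y => ((y ^ (α * μ / 2 - 1) : ℝ) : ℂ) *
    densityH α μ β m ((ℓ x + α / 2 * Real.log y : ℝ) : ℂ) * Complex.exp (-(s * γ₀) * y) with hG
  have hLap : ∀ x, IntegrableOn (G x) (Set.Ioi 0) ∧ ∫ y in Set.Ioi (0 : ℝ), G x y =
      ((Real.exp (-(μ * ℓ x)) : ℝ) : ℂ) * mgfH α μ β m (ℓ x - α / 2 * Complex.log (s * γ₀)) :=
    fun x => laplace_densityH hα hμ hβ (by linarith) hS
  have hGint : ∀ x, IntegrableOn (fun γ => G x (γ₀⁻¹ * γ)) (Set.Ioi 0) := fun x => by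
    refine (integrableOn_Ioi_comp_mul_left_iff (G x) 0 (inv_pos.mpr hγ₀)).mpr ?_
    rw [mul_zero]
    exact (hLap x).1
  have hGval : ∀ x, ∫ γ in Set.Ioi (0 : ℝ), G x (γ₀⁻¹ * γ) =
      γ₀ * (((Real.exp (-(μ * ℓ x)) : ℝ) : ℂ) *
        mgfH α μ β m (ℓ x - α / 2 * Complex.log (s * γ₀))) := fun x => by
    rw [integral_comp_mul_left_Ioi (G x) 0 (inv_pos.mpr hγ₀), mul_zero, (hLap x).2, inv_inv,
      Complex.real_smul]
  set K : ℝ := 2 * RM * c₁ α μ β lam m * c ^ (-(μ + m)) / (d₀ * γ₀ * Real.Gamma (μ + m)) with hK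
  set A : Fin l → ℝ → ℝ := fun i x =>
    B i * (d₀ / RM) ^ (b i + 1) * glWeight N x * Phi₁ α μ δ κ d₀ RM (b i) x with hA
  have hpoint : Set.EqOn (fun γ : ℝ =>
        snrPDF α μ β lam m δ γ₀ κ d₀ RM B b N γ * Complex.exp (-s * γ))
      (fun γ => ∑ i, ∑ x ∈ glNodes N, (K : ℂ) * (A i x : ℂ) * G x (γ₀⁻¹ * γ)) (Set.Ioi 0) := by
    intro γ hγ
    have hγ : 0 < γ := hγ
    simp only [snrPDF, Finset.mul_sum, Finset.sum_mul]
    refine Finset.sum_congr rfl fun i _ => Finset.sum_congr rfl fun x hx => ?_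
    have hΦ : 0 < Phi₂ α δ κ d₀ RM x := Phi_pos (by positivity) (mem_Ioo_of_mem_glNodes hx).1
    have hlog : Real.log (Phi₂ α δ κ d₀ RM x / c * (γ / γ₀) ^ (α / 2)) =
        ℓ x + α / 2 * Real.log (γ₀⁻¹ * γ) := by
      rw [Real.log_mul (div_pos hΦ hc₂).ne' (Real.rpow_pos_of_pos (div_pos hγ hγ₀) _).ne',
        Real.log_rpow (div_pos hγ hγ₀), div_eq_inv_mul γ]
    have hexp : Complex.exp (-(s * γ₀) * ((γ₀⁻¹ * γ : ℝ) : ℂ)) = Complex.exp (-s * γ) := by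
      have : (γ₀ : ℂ) ≠ 0 := by exact_mod_cast hγ₀.ne'
      congr 1
      push_cast
      field_simp
    rw [← hc, hlog, ← hK]
    simp only [hG, hA]
    rw [hexp, div_eq_inv_mul γ, Complex.ofReal_mul K]
    unfold densityH
    ring
  refine ⟨IntegrableOn.congr_fun (integrable_finsetSum _ fun i _ => integrable_finsetSum _
    fun x _ => (hGint x).const_mul _) hpoint.symm measurableSet_Ioi, ?_⟩
  rw [setIntegral_congr_fun measurableSet_Ioi hpoint, integral_finsetSum _ fun i _ =>
    integrable_finsetSum _ fun x _ => (hGint x).const_mul _]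
  simp only [snrMGF, Finset.mul_sum]
  refine Finset.sum_congr rfl fun i _ => ?_
  rw [integral_finsetSum _ fun x _ => (hGint x).const_mul _]
  refine Finset.sum_congr rfl fun x hx => ?_
  have hΦ : 0 < Phi₂ α δ κ d₀ RM x := Phi_pos (by positivity) (mem_Ioo_of_mem_glNodes hx).1
  have hreal : K * A i x * γ₀ * Real.exp (-(μ * ℓ x)) =
      2 * RM * c₁ α μ β lam m * c ^ (-m) / (d₀ * Real.Gamma (μ + m)) *
        (B i * (d₀ / RM) ^ (b i + 1) *
          (glWeight N x * Phi₁ α μ δ κ d₀ RM (b i) x / Phi₂ α δ κ d₀ RM x ^ μ)) := by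
    have h1 : Real.exp (-(μ * ℓ x)) = c ^ μ / Phi₂ α δ κ d₀ RM x ^ μ := by
      rw [hℓ, Real.exp_neg, mul_comm, ← Real.rpow_def_of_pos (div_pos hΦ hc₂),
        Real.div_rpow hΦ.le hc₂.le, inv_div]
    have h2 : c ^ (-m) = c ^ (-(μ + m)) * c ^ μ := by
      rw [← Real.rpow_add hc₂]; ring_nf
    rw [h1, h2, hK, hA]
    have hΓ : Real.Gamma (μ + m) ≠ 0 := (Real.Gamma_pos_of_pos (by linarith)).ne'
    have := (Real.rpow_pos_of_pos hΦ μ).ne'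
    field_simp
  have hcomplex := congrArg Complex.ofReal hreal
  rw [Complex.ofReal_mul (K * A i x * γ₀), Complex.ofReal_mul (K * A i x), Complex.ofReal_mul K,
    Complex.ofReal_mul (2 * RM * _ * _ / _)] at hcomplex
  rw [integral_const_mul, hGval, ← hc]
  change _ = _ * (_ * mgfH α μ β m (ℓ x - α / 2 * Complex.log (s * γ₀)))
  linear_combination mgfH α μ β m (ℓ x - α / 2 * Complex.log (s * γ₀)) * hcomplex

/-! ### The law of the product of pointing error and fading -/

lemma measurable_pointingPDF (β : ℝ) : Measurable (pointingPDF β) := by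
  unfold pointingPDF
  exact Measurable.ite measurableSet_Ioo (by fun_prop) measurable_const

lemma pointingPDF_of_mem {β z : ℝ} (hz : z ∈ Set.Ioo (0 : ℝ) 1) :
    pointingPDF β z = -(β ^ 2 / 4) * Real.log z * z ^ (β / 2 - 1) :=
  if_pos hz

lemma pointingPDF_of_notMem {β z : ℝ} (hz : z ∉ Set.Ioo (0 : ℝ) 1) : pointingPDF β z = 0 :=
  if_neg hz

lemma alphaFPDF_of_nonpos {α μ m lam w x : ℝ} (hx : x ≤ 0) : alphaFPDF α μ m lam w x = 0 :=
  if_neg hx.not_gt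

lemma measurable_alphaFPDF (α μ m lam w : ℝ) : Measurable (alphaFPDF α μ m lam w) := by
  unfold alphaFPDF
  exact Measurable.ite measurableSet_Ioi (by fun_prop) measurable_const

lemma pointingPDF_nonneg (β z : ℝ) : 0 ≤ pointingPDF β z := by
  unfold pointingPDF
  split_ifs with h
  · have h1 := Real.log_nonpos h.1.le h.2.le
    have h2 := Real.rpow_nonneg h.1.le (β / 2 - 1)
    have h3 : 0 ≤ β ^ 2 / 4 * -Real.log z := mul_nonneg (by positivity) (by linarith)
    have := mul_nonneg h3 h2
    linarith
  · exact le_rfl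

lemma alphaFPDF_nonneg {α μ m lam w : ℝ} (hα : 0 < α) (hμ : 0 < μ) (hm : 1 < m) (hlam : 0 < lam)
    (hw : 0 < w) (x : ℝ) : 0 ≤ alphaFPDF α μ m lam w x := by
  unfold alphaFPDF
  split_ifs with h
  · have h1 : 0 < m - 1 := by linarith
    have h2 := beta_pos hμ (zero_lt_one.trans hm)
    positivity
  · exact le_rfl

lemma integrable_of_map_eq_withDensity {Ω : Type*} [MeasurableSpace Ω] {P : Measure Ω}
    [IsProbabilityMeasure P] {X : Ω → ℝ} {f : ℝ → ℝ} (hX : Measurable X) (hf : Measurable f)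
    (hf0 : ∀ x, 0 ≤ f x)
    (hlaw : P.map X = volume.withDensity (fun x => ENNReal.ofReal (f x))) : Integrable f := by
  have hprob : IsProbabilityMeasure (P.map X) := Measure.isProbabilityMeasure_map hX.aemeasurable
  refine ⟨hf.aestronglyMeasurable, ?_⟩
  rw [hasFiniteIntegral_iff_ofReal (ae_of_all _ hf0)]
  have h1 := hprob.measure_univ
  rw [hlaw, withDensity_apply _ MeasurableSet.univ, Measure.restrict_univ] at h1
  rw [h1]
  exact ENNReal.one_lt_top

lemma integral_eq_of_map_eq_withDensity {Ω E : Type*} [MeasurableSpace Ω] {P : Measure Ω}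
    [NormedAddCommGroup E] [NormedSpace ℝ E] {X : Ω → ℝ} {f : ℝ → ℝ} (hf : Measurable f)
    (hf0 : ∀ x, 0 ≤ f x)
    (hlaw : P.map X = volume.withDensity (fun x => ENNReal.ofReal (f x))) (g : ℝ → E) :
    ∫ x, g x ∂(P.map X) = ∫ x, f x • g x := by
  rw [hlaw, integral_withDensity_eq_integral_toReal_smul hf.ennreal_ofReal
    (ae_of_all _ fun _ => ENNReal.ofReal_lt_top)]
  simp only [ENNReal.toReal_ofReal (hf0 _)]

lemma ae_mem_of_map_eq_withDensity {Ω : Type*} [MeasurableSpace Ω] {P : Measure Ω}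
    {X : Ω → ℝ} {f : ℝ → ℝ} {t : Set ℝ} (hX : Measurable X) (ht : MeasurableSet t)
    (hf0 : ∀ x, x ∉ t → f x = 0)
    (hlaw : P.map X = volume.withDensity (fun x => ENNReal.ofReal (f x))) :
    ∀ᵐ ω ∂P, X ω ∈ t := by
  have h : ∀ᵐ x ∂(P.map X), x ∈ t := by
    change (P.map X) tᶜ = 0
    rw [hlaw, withDensity_apply _ ht.compl, setLIntegral_congr_fun (g := fun _ => 0) ht.compl
      (fun x hx => by simp [hf0 x hx])]
    simp
  exact ae_of_ae_map hX.aemeasurable h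

lemma integral_pointingPDF_mul_self {β : ℝ} (hβ : 0 < β) :
    ∫ z, pointingPDF β z * z = β ^ 2 / (β + 2) ^ 2 := by
  have hmom := (integral_neg_log_mul_cpow (s := ((β / 2 + 1 : ℝ) : ℂ))
    (by rw [Complex.ofReal_re]; linarith)).2
  have h1 : ∫ z, pointingPDF β z * z = ∫ z in Set.Ioo (0 : ℝ) 1, pointingPDF β z * z := by
    refine (setIntegral_eq_integral_of_forall_compl_eq_zero fun z hz => ?_).symm
    rw [pointingPDF_of_notMem hz, zero_mul]
  have h2 : Set.EqOn (fun z : ℝ => ((-Real.log z : ℝ) : ℂ) *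
      (z : ℂ) ^ (((β / 2 + 1 : ℝ) : ℂ) - 1))
      (fun z => ((-Real.log z * z ^ (β / 2) : ℝ) : ℂ)) (Set.Ioo 0 1) := by
    intro z hz
    simp only [Complex.ofReal_mul]
    rw [Complex.ofReal_cpow hz.1.le]
    congr 2
    push_cast
    ring
  rw [setIntegral_congr_fun measurableSet_Ioo h2, integral_complex_ofReal] at hmom
  have h3 : ∫ z in Set.Ioo (0 : ℝ) 1, -Real.log z * z ^ (β / 2) = 1 / (β / 2 + 1) ^ 2 := by
    exact_mod_cast hmom
  have h4 : Set.EqOn (fun z => pointingPDF β z * z)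
      (fun z => β ^ 2 / 4 * (-Real.log z * z ^ (β / 2))) (Set.Ioo 0 1) := by
    intro z hz
    have : z ^ (β / 2) = z ^ (β / 2 - 1) * z := by
      rw [← Real.rpow_add_one hz.1.ne']; ring_nf
    simp only
    rw [pointingPDF_of_mem hz, this]
    ring
  rw [h1, setIntegral_congr_fun measurableSet_Ioo h4, integral_const_mul, h3]
  field_simp
  ring

/-- The density of the product: the multiplicative convolution of the two densities is a
`logMixture`. -/
lemma pointingPDF_mul_alphaFPDF {α μ m lam w β r : ℝ}
    (hr : r = (m - 1) * w ^ (α / 2) / (lam ^ (α / 2) * μ)) (hr0 : 0 < r) {y z : ℝ} (hy : 0 < y)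
    (hz : z ∈ Set.Ioo (0 : ℝ) 1) :
    pointingPDF β z * (z⁻¹ * alphaFPDF α μ m lam w (z⁻¹ * y)) =
      β ^ 2 * α / (8 * ProbabilityTheory.beta μ m) * r ^ m * r ^ (-(μ + m)) *
        y ^ (α * μ / 2 - 1) * (-Real.log z * z ^ ((β - α * μ) / 2 - 1) *
          (1 + z ^ (-α / 2) * (y ^ (α / 2) / r)) ^ (-(μ + m))) := by
  have hz0 := hz.1
  rw [pointingPDF_of_mem hz, alphaFPDF, if_pos (by positivity), ← hr,
    Real.mul_rpow (by positivity) hy.le, Real.mul_rpow (by positivity) hy.le,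
    Real.inv_rpow hz0.le, Real.inv_rpow hz0.le, ← Real.rpow_neg hz0.le, ← Real.rpow_neg hz0.le,
    ← Real.rpow_neg_one z]
  have h1 : z ^ (-(α / 2)) * y ^ (α / 2) + r = r * (1 + z ^ (-α / 2) * (y ^ (α / 2) / r)) := by
    rw [neg_div]
    field_simp
    ring
  have h2 : z ^ ((β - α * μ) / 2 - 1) =
      z ^ (β / 2 - 1) * z ^ (-1 : ℝ) * z ^ (-(α * μ / 2 - 1)) := by
    rw [← Real.rpow_add hz0, ← Real.rpow_add hz0]
    congr 1
    ring
  rw [h1, Real.mul_rpow hr0.le (by positivity), h2, add_comm m μ]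
  ring

lemma norm_exp_neg_mul_le_one {S : ℂ} (hS : 0 < S.re) {y : ℝ} (hy : 0 ≤ y) :
    ‖Complex.exp (-S * y)‖ ≤ 1 := by
  rw [Complex.norm_exp]
  refine Real.exp_le_one_iff.mpr ?_
  have : (-S * y).re = -(S.re * y) := by simp
  rw [this]
  have := mul_nonneg hS.le hy
  linarith

/-- The moment generating function of the product of pointing error and fading power: its density
is, by Mellin inversion, a power times the density H-function, of which the Laplace transform is
known. -/
lemma integral_exp_neg_mul_product {Ω : Type*} [MeasurableSpace Ω] {P : Measure Ω}
    [IsProbabilityMeasure P] {α μ m lam w β r : ℝ} {Z X : Ω → ℝ} {S : ℂ}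
    (hα : 0 < α) (hμ : 0 < μ) (hlam : 0 < lam) (hm : 1 < m) (hβ : 0 < β) (hw : 0 < w)
    (hr : r = (m - 1) * w ^ (α / 2) / (lam ^ (α / 2) * μ)) (hr0 : 0 < r)
    (hZ : Measurable Z) (hX : Measurable X) (hind : IndepFun Z X P)
    (lawZ : P.map Z = volume.withDensity (fun z => ENNReal.ofReal (pointingPDF β z)))
    (lawX : P.map X = volume.withDensity (fun x => ENNReal.ofReal (alphaFPDF α μ m lam w x)))
    (hS : 0 < S.re) :
    ∫ ω, Complex.exp (-S * ((Z ω * X ω : ℝ) : ℂ)) ∂P =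
      ((β ^ 2 * α / (8 * ProbabilityTheory.beta μ m) * r ^ m * r ^ (-(μ + m)) *
        (4 / Real.Gamma (μ + m)) * r ^ μ : ℝ) : ℂ) *
        mgfH α μ β m (((-Real.log r : ℝ) : ℂ) - α / 2 * Complex.log S) := by
  have hX0 := alphaFPDF_nonneg hα hμ hm hlam hw
  have hZ0 := pointingPDF_nonneg β
  have hXm := measurable_alphaFPDF α μ m lam w
  have hZm := measurable_pointingPDF β
  have hXi := integrable_of_map_eq_withDensity hX hXm hX0 lawX
  have hZi := integrable_of_map_eq_withDensity hZ hZm hZ0 lawZ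
  set C : ℝ := β ^ 2 * α / (8 * ProbabilityTheory.beta μ m) * r ^ m * r ^ (-(μ + m)) with hC
  set e : ℝ → ℂ := fun y => Complex.exp (-S * y) with he
  have hem : Measurable e := by fun_prop
  -- Pass to the product of the two laws.
  have hprod := (indepFun_iff_map_prod_eq_prod_map_map hZ.aemeasurable hX.aemeasurable).mp hind
  have hpair : Measurable fun ω => (Z ω, X ω) := hZ.prodMk hX
  have hmeas : Measurable fun p : ℝ × ℝ => e (p.1 * p.2) := by fun_prop
  have hint : Integrable (fun p : ℝ × ℝ => e (p.1 * p.2)) ((P.map Z).prod (P.map X)) := by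
    rw [← hprod, integrable_map_measure hmeas.aestronglyMeasurable hpair.aemeasurable]
    refine Integrable.mono' (integrable_const 1) (hmeas.comp hpair).aestronglyMeasurable ?_
    filter_upwards [ae_mem_of_map_eq_withDensity hZ measurableSet_Ioo
      (fun z hz => pointingPDF_of_notMem hz) lawZ,
      ae_mem_of_map_eq_withDensity hX measurableSet_Ioi
      (fun x hx => alphaFPDF_of_nonpos (not_lt.mp hx)) lawX] with ω h1 h2
    exact norm_exp_neg_mul_le_one hS (mul_pos h1.1 h2).le
  have hstep1 : ∫ ω, e (Z ω * X ω) ∂P =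
      ∫ z in Set.Ioo (0 : ℝ) 1, (pointingPDF β z : ℂ) *
        ∫ x in Set.Ioi (0 : ℝ), (alphaFPDF α μ m lam w x : ℂ) * e (z * x) := by
    rw [← integral_map (f := fun p : ℝ × ℝ => e (p.1 * p.2)) hpair.aemeasurable
      hmeas.aestronglyMeasurable, hprod, integral_prod _ hint,
      integral_eq_of_map_eq_withDensity hZm hZ0 lawZ,
      ← setIntegral_eq_integral_of_forall_compl_eq_zero (s := Set.Ioo (0 : ℝ) 1)
        fun z hz => by rw [pointingPDF_of_notMem hz, zero_smul]]
    refine integral_congr_ae (ae_of_all _ fun z => ?_)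
    simp only
    rw [integral_eq_of_map_eq_withDensity hXm hX0 lawX,
      ← setIntegral_eq_integral_of_forall_compl_eq_zero (s := Set.Ioi (0 : ℝ))
        fun x hx => by rw [alphaFPDF_of_nonpos (not_lt.mp hx), zero_smul]]
    simp only [Complex.real_smul]
  -- Substitute `y = z x` in the inner integral and exchange the integrals.
  set h : ℝ → ℝ → ℝ := fun z y => pointingPDF β z * (z⁻¹ * alphaFPDF α μ m lam w (z⁻¹ * y)) with hh
  have hhm : Measurable (Function.uncurry h) := by
    simp only [hh, Function.uncurry_def]
    fun_prop
  have hhint : Integrable (Function.uncurry h)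
      ((volume.restrict (Set.Ioo 0 1)).prod (volume.restrict (Set.Ioi 0))) := by
    refine (integrable_prod_iff hhm.aestronglyMeasurable).mpr ⟨?_, ?_⟩
    · filter_upwards [ae_restrict_mem measurableSet_Ioo] with z hz
      have h1 : IntegrableOn (fun y => alphaFPDF α μ m lam w (z⁻¹ * y)) (Set.Ioi 0) := by
        refine (integrableOn_Ioi_comp_mul_left_iff _ 0 (inv_pos.mpr hz.1)).mpr ?_
        exact hXi.integrableOn
      exact (h1.const_mul z⁻¹).const_mul (pointingPDF β z)
    · refine ((hZi.integrableOn (s := Set.Ioo 0 1)).mul_const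
        (∫ x in Set.Ioi (0 : ℝ), alphaFPDF α μ m lam w x)).congr ?_
      filter_upwards [ae_restrict_mem measurableSet_Ioo] with z hz
      have h1 : ∀ y, ‖Function.uncurry h (z, y)‖ = h z y := fun y =>
        Real.norm_of_nonneg (mul_nonneg (hZ0 z) (mul_nonneg (inv_pos.mpr hz.1).le (hX0 _)))
      rw [integral_congr_ae (ae_of_all _ h1)]
      simp only [hh]
      rw [integral_const_mul, integral_const_mul,
        integral_comp_mul_left_Ioi (alphaFPDF α μ m lam w) 0 (inv_pos.mpr hz.1), mul_zero, inv_inv,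
        smul_eq_mul, inv_mul_cancel_left₀ hz.1.ne']
  have hHint : Integrable (Function.uncurry fun z y => (h z y : ℂ) * e y)
      ((volume.restrict (Set.Ioo 0 1)).prod (volume.restrict (Set.Ioi 0))) := by
    refine Integrable.mono' hhint.norm (Measurable.aestronglyMeasurable ?_) ?_
    · exact (Complex.measurable_ofReal.comp hhm).mul (hem.comp measurable_snd)
    · have hae : ∀ᵐ p : ℝ × ℝ ∂((volume.restrict (Set.Ioo 0 1)).prod
          (volume.restrict (Set.Ioi 0))), 0 < p.2 :=
        Measure.quasiMeasurePreserving_snd.ae (ae_restrict_mem measurableSet_Ioi)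
      filter_upwards [hae] with p hp
      simp only [Function.uncurry, norm_mul, Complex.norm_real]
      exact mul_le_of_le_one_right (norm_nonneg _) (norm_exp_neg_mul_le_one hS hp.le)
  have hstep2 : ∫ z in Set.Ioo (0 : ℝ) 1, (pointingPDF β z : ℂ) *
        ∫ x in Set.Ioi (0 : ℝ), (alphaFPDF α μ m lam w x : ℂ) * e (z * x) =
      ∫ y in Set.Ioi (0 : ℝ), ∫ z in Set.Ioo (0 : ℝ) 1, (h z y : ℂ) * e y := by
    rw [← integral_integral_swap hHint]
    refine setIntegral_congr_fun measurableSet_Ioo fun z hz => ?_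
    have h1 := integral_comp_mul_left_Ioi
      (fun x => (alphaFPDF α μ m lam w x : ℂ) * e (z * x)) 0 (inv_pos.mpr hz.1)
    have hz0 : (z : ℂ) ≠ 0 := by exact_mod_cast hz.1.ne'
    rw [mul_zero, inv_inv, Complex.real_smul] at h1
    simp only [mul_inv_cancel_left₀ hz.1.ne'] at h1
    simp only [hh, Complex.ofReal_mul, mul_assoc]
    rw [integral_const_mul, integral_const_mul, h1, Complex.ofReal_inv, inv_mul_cancel_left₀ hz0]
  -- The inner integral is now the density, expressed by the H-function.
  have hstep3 : Set.EqOn (fun y : ℝ => ∫ z in Set.Ioo (0 : ℝ) 1, (h z y : ℂ) * e y)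
      (fun y => ((C * (4 / Real.Gamma (μ + m)) : ℝ) : ℂ) * (((y ^ (α * μ / 2 - 1) : ℝ) : ℂ) *
        densityH α μ β m ((-Real.log r + α / 2 * Real.log y : ℝ) : ℂ) * e y)) (Set.Ioi 0) := by
    intro y hy
    have hy : 0 < y := hy
    have hyr : 0 < y ^ (α / 2) / r := by positivity
    have hlog : Real.log (y ^ (α / 2) / r) = -Real.log r + α / 2 * Real.log y := by
      rw [Real.log_div (by positivity) hr0.ne', Real.log_rpow hy]
      ring
    have hmix : ∫ z in Set.Ioo (0 : ℝ) 1, h z y =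
        C * y ^ (α * μ / 2 - 1) * logMixture α (μ + m) (β - α * μ) (y ^ (α / 2) / r) := by
      rw [logMixture, ← integral_const_mul]
      exact setIntegral_congr_fun measurableSet_Ioo fun z hz =>
        pointingPDF_mul_alphaFPDF hr hr0 hy hz
    have hG : Complex.Gamma (μ + m) ≠ 0 :=
      Complex.Gamma_ne_zero_of_re_pos (by simp; linarith)
    have hGr : ((Real.Gamma (μ + m) : ℝ) : ℂ) = Complex.Gamma (μ + m) := by
      rw [← Complex.Gamma_ofReal]; push_cast; rfl
    simp only
    rw [integral_mul_const, integral_complex_ofReal, hmix, ← hlog,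
      foxH_density_eq hα hμ hβ (by linarith) hyr]
    simp only [Complex.ofReal_mul, Complex.ofReal_div, hGr, Complex.ofReal_ofNat]
    field_simp
  obtain ⟨-, hlap⟩ := laplace_densityH (ℓ := -Real.log r) hα hμ hβ (m := m) (by linarith) hS
  rw [hstep1, hstep2, setIntegral_congr_fun measurableSet_Ioi hstep3, integral_const_mul, hlap,
    show Real.exp (-(μ * -Real.log r)) = r ^ μ by
      rw [Real.rpow_def_of_pos hr0]; ring_nf,
    ← mul_assoc, ← Complex.ofReal_mul]

/-! ### Convergence of the quadrature form -/

/-- The moment generating function of `ρ x * Y`, as a function of `x`, extended by its limit `0` at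
the point `-1`, where `ρ` tends to infinity. The value at `-1` is prescribed by the case
distinction since Lean's `0 ^ (-δ) = 0` would make the gain vanish there. -/
noncomputable def scaledMGF {Ω : Type*} [MeasurableSpace Ω] (P : Measure Ω) (Y : Ω → ℝ) (ρ : ℝ → ℝ)
    (s : ℂ) (x : ℝ) : ℂ :=
  ∫ ω, (if x ≤ -1 then 0 else Complex.exp (-s * ((ρ x * Y ω : ℝ) : ℂ))) ∂P

lemma scaledMGF_of_lt {Ω : Type*} [MeasurableSpace Ω] {P : Measure Ω} {Y : Ω → ℝ} {ρ : ℝ → ℝ}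
    {s : ℂ} {x : ℝ} (hx : -1 < x) :
    scaledMGF P Y ρ s x = ∫ ω, Complex.exp (-s * ((ρ x * Y ω : ℝ) : ℂ)) ∂P := by
  simp only [scaledMGF, if_neg hx.not_ge]

lemma continuousOn_scaledMGF {Ω : Type*} [MeasurableSpace Ω] {P : Measure Ω}
    [IsProbabilityMeasure P] {Y : Ω → ℝ} {ρ : ℝ → ℝ} {s : ℂ} (hs : 0 < s.re) (hY : Measurable Y)
    (hYpos : ∀ᵐ ω ∂P, 0 < Y ω) (hρ : ∀ x, -1 < x → 0 ≤ ρ x)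
    (hρc : ∀ x, -1 < x → ContinuousAt ρ x) (hρt : Tendsto ρ (𝓝[>] (-1)) atTop) :
    ContinuousOn (scaledMGF P Y ρ s) (Set.Icc (-1) 1) := by
  unfold scaledMGF
  refine continuousOn_of_dominated (bound := fun _ => 1) (fun x _ => ?_) (fun x _ => ?_)
    (integrable_const 1) ?_
  · by_cases hx : x ≤ -1
    · simp only [if_pos hx]
      exact aestronglyMeasurable_const
    · simp only [if_neg hx]
      exact Measurable.aestronglyMeasurable (by fun_prop)
  · filter_upwards [hYpos] with ω hω
    split_ifs with hx
    · simp
    · exact norm_exp_neg_mul_le_one hs (mul_nonneg (hρ x (not_le.mp hx)) hω.le)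
  · filter_upwards [hYpos] with ω hω x hx
    rcases hx.1.eq_or_lt with rfl | hx1
    · rw [ContinuousWithinAt, if_pos le_rfl]
      have hlim : Tendsto (fun x => Complex.exp (-s * ((ρ x * Y ω : ℝ) : ℂ))) (𝓝[>] (-1)) (𝓝 0) := by
        rw [tendsto_zero_iff_norm_tendsto_zero]
        have hre : ∀ y : ℝ, (-s * (y : ℂ)).re = -(s.re * y) := fun y => by simp
        simp only [Complex.norm_exp, hre]
        exact Real.tendsto_exp_neg_atTop_nhds_zero.comp
          ((hρt.atTop_mul_const hω).const_mul_atTop hs)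
      rw [Metric.tendsto_nhds] at hlim ⊢
      intro ε hε
      have h1 := eventually_nhdsWithin_iff.mp (hlim ε hε)
      refine eventually_nhdsWithin_iff.mpr ?_
      filter_upwards [h1] with y hy _
      split_ifs with hy1
      · simpa using hε
      · exact hy (not_le.mp hy1)
    · refine ContinuousAt.continuousWithinAt ?_
      have hc : ContinuousAt (fun x => Complex.exp (-s * ((ρ x * Y ω : ℝ) : ℂ))) x := by
        have := hρc x hx1
        fun_prop
      refine hc.congr ?_
      filter_upwards [lt_mem_nhds hx1] with y hy
      rw [if_neg hy.not_ge]

/-- The SNR per unit of channel power at the quadrature abscissa `x`, which stands for the distance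
`1 + RM / (2 d₀) * (x + 1)`. -/
noncomputable def gain (γ₀ δ κ d₀ RM x : ℝ) : ℝ :=
  γ₀ * (RM / (2 * d₀) * (x + 1)) ^ (-δ) * Real.exp (-κ * d₀ * (1 + RM / (2 * d₀) * (x + 1)))

lemma gain_pos {γ₀ δ κ d₀ RM x : ℝ} (hγ₀ : 0 < γ₀) (hd₀ : 0 < d₀) (hRM : 0 < RM) (hx : -1 < x) :
    0 < gain γ₀ δ κ d₀ RM x := by
  have : 0 < RM / (2 * d₀) * (x + 1) := mul_pos (by positivity) (by linarith)
  unfold gain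
  positivity

lemma continuousAt_gain {γ₀ δ κ d₀ RM x : ℝ} (hd₀ : 0 < d₀) (hRM : 0 < RM) (hx : -1 < x) :
    ContinuousAt (gain γ₀ δ κ d₀ RM) x := by
  have : 0 < RM / (2 * d₀) * (x + 1) := mul_pos (by positivity) (by linarith)
  unfold gain
  refine ContinuousAt.mul (continuousAt_const.mul (ContinuousAt.rpow_const (by fun_prop)
    (Or.inl this.ne'))) (by fun_prop)

lemma tendsto_gain {γ₀ δ κ d₀ RM : ℝ} (hγ₀ : 0 < γ₀) (hδ : 0 < δ) (hd₀ : 0 < d₀) (hRM : 0 < RM) :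
    Tendsto (gain γ₀ δ κ d₀ RM) (𝓝[>] (-1)) atTop := by
  have ha : 0 < RM / (2 * d₀) := by positivity
  have hu : Tendsto (fun x : ℝ => RM / (2 * d₀) * (x + 1)) (𝓝[>] (-1)) (𝓝[>] 0) := by
    refine tendsto_nhdsWithin_iff.mpr ⟨?_, ?_⟩
    · have : Continuous fun x : ℝ => RM / (2 * d₀) * (x + 1) := by fun_prop
      have h := this.tendsto (-1)
      norm_num at h
      exact h.mono_left nhdsWithin_le_nhds
    · filter_upwards [self_mem_nhdsWithin] with x hx
      have hx : -1 < x := hx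
      exact mul_pos ha (by linarith)
  have h1 : Tendsto (fun u : ℝ => u ^ (-δ)) (𝓝[>] 0) atTop :=
    tendsto_rpow_neg_nhdsGT_zero (neg_lt_zero.mpr hδ)
  have h2 : Tendsto (fun x : ℝ => Real.exp (-κ * d₀ * (1 + RM / (2 * d₀) * (x + 1)))) (𝓝[>] (-1))
      (𝓝 (Real.exp (-κ * d₀ * (1 + RM / (2 * d₀) * (-1 + 1))))) :=
    (Continuous.tendsto (by fun_prop) _).mono_left nhdsWithin_le_nhds
  unfold gain
  exact ((h1.comp hu).const_mul_atTop hγ₀).atTop_mul_pos (Real.exp_pos _) h2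

lemma log_Phi₂ {α γ₀ δ κ d₀ RM x : ℝ} (hγ₀ : 0 < γ₀) (hd₀ : 0 < d₀) (hRM : 0 < RM) (hx : -1 < x) :
    Real.log (Phi₂ α δ κ d₀ RM x) =
      α / 2 * Real.log γ₀ - α / 2 * Real.log (gain γ₀ δ κ d₀ RM x) := by
  have hu : 0 < RM / (2 * d₀) * (x + 1) := mul_pos (by positivity) (by linarith)
  unfold Phi₂ Phi gain
  set u := RM / (2 * d₀) * (x + 1)
  have h1 := Real.rpow_pos_of_pos hu (α * δ / 2)
  have h2 := Real.rpow_pos_of_pos hu (-δ)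
  rw [Real.log_mul h1.ne' (Real.exp_pos _).ne', Real.log_mul (by positivity) (Real.exp_pos _).ne',
    Real.log_mul hγ₀.ne' h2.ne', Real.log_exp, Real.log_exp, Real.log_rpow hu, Real.log_rpow hu]
  ring

/-- The quadrature form is a combination of Gauss–Legendre sums for the functions
`(a₁ (x + 1)) ^ bᵢ * V x`, where `V` stands for the conditional moment generating function. -/
lemma snrMGF_eq_sum {α μ β lam m δ γ₀ κ d₀ RM : ℝ} {l : ℕ} {B b : Fin l → ℝ} {s : ℂ} {V : ℝ → ℂ}
    (hd₀ : 0 < d₀) (hRM : 0 < RM)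
    (hV : ∀ x, -1 < x → V x =
      ((c₁ α μ β lam m * c₂ α μ β lam m ^ (-m) * (4 / Real.Gamma (μ + m)) : ℝ) : ℂ) *
        mgfH α μ β m (((Real.log (Phi₂ α δ κ d₀ RM x / c₂ α μ β lam m) : ℝ) : ℂ) -
          α / 2 * Complex.log (s * γ₀))) (N : ℕ) :
    snrMGF α μ β lam m δ γ₀ κ d₀ RM B b N s =
      ∑ i, ((RM / (2 * d₀) * (B i * (d₀ / RM) ^ (b i + 1)) : ℝ) : ℂ) *
        ∑ x ∈ glNodes N, (glWeight N x : ℂ) *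
          ((((RM / (2 * d₀) * (x + 1)) ^ b i : ℝ) : ℂ) * V x) := by
  simp only [snrMGF, Finset.mul_sum]
  refine Finset.sum_congr rfl fun i _ => Finset.sum_congr rfl fun x hx => ?_
  have hx1 := (mem_Ioo_of_mem_glNodes hx).1
  rw [hV x hx1, mul_div_assoc (glWeight N x), Phi₁_div_Phi₂_rpow hd₀ hRM hx1]
  have hreal : 2 * RM * c₁ α μ β lam m * c₂ α μ β lam m ^ (-m) / (d₀ * Real.Gamma (μ + m)) *
      (B i * (d₀ / RM) ^ (b i + 1) * (glWeight N x * (RM / (2 * d₀) * (x + 1)) ^ b i)) =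
      RM / (2 * d₀) * (B i * (d₀ / RM) ^ (b i + 1)) * (glWeight N x *
        ((RM / (2 * d₀) * (x + 1)) ^ b i *
          (c₁ α μ β lam m * c₂ α μ β lam m ^ (-m) * (4 / Real.Gamma (μ + m))))) := by
    field_simp
    ring
  unfold mgfH
  rw [← mul_assoc, ← Complex.ofReal_mul, hreal]
  simp only [Complex.ofReal_mul, mul_assoc]

/-! ### The moment generating function of the SNR -/

lemma measurable_rwpPDF {d₀ RM : ℝ} {l : ℕ} (B b : Fin l → ℝ) :
    Measurable (rwpPDF d₀ RM B b) := by
  unfold rwpPDF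
  exact Measurable.ite measurableSet_Ioo (by fun_prop) measurable_const

lemma rwpPDF_of_mem {d₀ RM : ℝ} {l : ℕ} {B b : Fin l → ℝ} {d : ℝ}
    (hd : d ∈ Set.Ioo 1 (1 + RM / d₀)) :
    rwpPDF d₀ RM B b d = ∑ i, B i * (d₀ / RM) ^ (b i + 1) * (d - 1) ^ (b i) :=
  if_pos hd

lemma rwpPDF_of_notMem {d₀ RM : ℝ} {l : ℕ} {B b : Fin l → ℝ} {d : ℝ}
    (hd : d ∉ Set.Ioo 1 (1 + RM / d₀)) : rwpPDF d₀ RM B b d = 0 :=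
  if_neg hd

lemma snr_eq_gain_mul {γ₀ δ κ d₀ RM x hp hf : ℝ} :
    snr γ₀ δ κ d₀ (RM / (2 * d₀) * x + (1 + RM / (2 * d₀))) hp hf =
      gain γ₀ δ κ d₀ RM x * (hp ^ 2 * hf ^ 2) := by
  rw [snr, gain, show RM / (2 * d₀) * x + (1 + RM / (2 * d₀)) - 1 = RM / (2 * d₀) * (x + 1) by ring,
    show RM / (2 * d₀) * x + (1 + RM / (2 * d₀)) = 1 + RM / (2 * d₀) * (x + 1) by ring]
  ring

/-- Averaging over the distance: the moment generating function of the SNR is the integral that the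
quadrature sums approximate. -/
lemma complexMGF_snr_eq {Ω : Type*} [MeasurableSpace Ω] {P : Measure Ω} [IsProbabilityMeasure P]
    {δ γ₀ κ d₀ RM : ℝ} {l : ℕ} {B b : Fin l → ℝ} {Hp Hf D : Ω → ℝ} {s : ℂ}
    (hγ₀ : 0 < γ₀) (hδ : 0 < δ) (hd₀ : 0 < d₀) (hRM : 0 < RM) (hb : ∀ i, 0 ≤ b i)
    (hDpos : ∀ d, 0 ≤ rwpPDF d₀ RM B b d)
    (hHp : Measurable Hp) (hHf : Measurable Hf) (hD : Measurable D)
    (hind : IndepFun (fun ω => Hp ω ^ 2 * Hf ω ^ 2) D P)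
    (hYpos : ∀ᵐ ω ∂P, 0 < Hp ω ^ 2 * Hf ω ^ 2)
    (lawD : P.map D = volume.withDensity (fun d => ENNReal.ofReal (rwpPDF d₀ RM B b d)))
    (hs : 0 < s.re) :
    complexMGF (fun ω => snr γ₀ δ κ d₀ (D ω) (Hp ω) (Hf ω)) P (-s) =
      ∑ i, ((RM / (2 * d₀) * (B i * (d₀ / RM) ^ (b i + 1)) : ℝ) : ℂ) *
        ∫ x in (-1 : ℝ)..1, (((RM / (2 * d₀) * (x + 1)) ^ b i : ℝ) : ℂ) *
          scaledMGF P (fun ω => Hp ω ^ 2 * Hf ω ^ 2) (gain γ₀ δ κ d₀ RM) s x := by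
  set Y : Ω → ℝ := fun ω => Hp ω ^ 2 * Hf ω ^ 2 with hYdef
  set V := scaledMGF P Y (gain γ₀ δ κ d₀ RM) s with hVdef
  set a := RM / (2 * d₀) with ha
  have ha0 : 0 < a := by positivity
  have hY : Measurable Y := by fun_prop
  set ψ : ℝ → ℝ → ℂ := fun y d => Complex.exp (-s *
    ((γ₀ * (d - 1) ^ (-δ) * Real.exp (-κ * d₀ * d) * y : ℝ) : ℂ)) with hψ
  have hψm : Measurable fun p : ℝ × ℝ => ψ p.1 p.2 := by
    simp only [hψ]
    fun_prop
  have hsnr : ∀ ω d, Complex.exp (-s * (snr γ₀ δ κ d₀ d (Hp ω) (Hf ω) : ℝ)) = ψ (Y ω) d := by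
    intro ω d
    simp only [hψ, snr, hYdef]
    ring_nf
  have hpair : Measurable fun ω => (Y ω, D ω) := hY.prodMk hD
  have hprod := (indepFun_iff_map_prod_eq_prod_map_map hY.aemeasurable hD.aemeasurable).mp hind
  have hPY : IsProbabilityMeasure (P.map Y) := Measure.isProbabilityMeasure_map hY.aemeasurable
  have hint : Integrable (fun p : ℝ × ℝ => ψ p.1 p.2) ((P.map Y).prod (P.map D)) := by
    rw [← hprod, integrable_map_measure hψm.aestronglyMeasurable hpair.aemeasurable]
    refine Integrable.mono' (integrable_const 1) (hψm.comp hpair).aestronglyMeasurable ?_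
    filter_upwards [ae_mem_of_map_eq_withDensity hD measurableSet_Ioo
      (fun d hd => rwpPDF_of_notMem hd) lawD, hYpos] with ω h1 h2
    have h3 : 0 < D ω - 1 := sub_pos.mpr h1.1
    exact norm_exp_neg_mul_le_one hs (by positivity)
  have hstep1 : complexMGF (fun ω => snr γ₀ δ κ d₀ (D ω) (Hp ω) (Hf ω)) P (-s) =
      ∫ d, rwpPDF d₀ RM B b d • ∫ ω, ψ (Y ω) d ∂P := by
    simp only [complexMGF, hsnr]
    rw [← integral_map (f := fun p : ℝ × ℝ => ψ p.1 p.2) hpair.aemeasurable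
      hψm.aestronglyMeasurable, hprod, integral_prod_symm _ hint,
      integral_eq_of_map_eq_withDensity (measurable_rwpPDF B b) hDpos lawD]
    refine integral_congr_ae (ae_of_all _ fun d => ?_)
    simp only
    rw [integral_map (f := fun y => ψ y d) hY.aemeasurable
      (hψm.comp (measurable_id.prodMk measurable_const)).aestronglyMeasurable]
  set f : ℝ → ℂ := fun d => (∑ i, B i * (d₀ / RM) ^ (b i + 1) * (d - 1) ^ (b i) : ℝ) •
    ∫ ω, ψ (Y ω) d ∂P with hf
  -- Substitute `d = a x + (1 + a)`, which maps `[-1, 1]` onto the support of the distance.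
  have hend : 1 + RM / d₀ = a * 1 + (1 + a) := by
    rw [ha]
    field_simp
    ring
  have hstep2 : ∫ d, rwpPDF d₀ RM B b d • ∫ ω, ψ (Y ω) d ∂P =
      ∫ d in (a * (-1) + (1 + a))..(a * 1 + (1 + a)), f d := by
    rw [← setIntegral_eq_integral_of_forall_compl_eq_zero (s := Set.Ioo 1 (1 + RM / d₀))
      fun d hd => by rw [rwpPDF_of_notMem hd, zero_smul], ← hend,
      show a * (-1) + (1 + a) = 1 by ring,
      intervalIntegral.integral_of_le (by linarith [div_pos hRM hd₀]),
      integral_Ioc_eq_integral_Ioo]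
    refine setIntegral_congr_fun measurableSet_Ioo fun d hd => ?_
    simp only [hf]
    rw [rwpPDF_of_mem hd]
  have hVc : ContinuousOn V (Set.Icc (-1) 1) :=
    continuousOn_scaledMGF hs hY hYpos (fun x hx => (gain_pos hγ₀ hd₀ hRM hx).le)
      (fun x hx => continuousAt_gain hd₀ hRM hx) (tendsto_gain hγ₀ hδ hd₀ hRM)
  have hterm : ∀ i, IntervalIntegrable (fun x => (((a * (x + 1)) ^ b i : ℝ) : ℂ) * V x) volume
      (-1) 1 := fun i => by
    refine ContinuousOn.intervalIntegrable ?_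
    rw [Set.uIcc_of_le (by norm_num)]
    refine ContinuousOn.mul (Continuous.continuousOn ?_) hVc
    exact Complex.continuous_ofReal.comp ((Real.continuous_rpow_const (hb i)).comp (by fun_prop))
  have hstep3 : ∫ d in (a * (-1) + (1 + a))..(a * 1 + (1 + a)), f d =
      ∫ x in (-1 : ℝ)..1, ∑ i, ((a * (B i * (d₀ / RM) ^ (b i + 1)) : ℝ) : ℂ) *
        ((((a * (x + 1)) ^ b i : ℝ) : ℂ) * V x) := by
    have hsub := intervalIntegral.integral_comp_mul_add (a := -1) (b := 1) f ha0.ne' (1 + a)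
    rw [eq_inv_smul_iff₀ ha0.ne'] at hsub
    rw [← hsub, Complex.real_smul, ← intervalIntegral.integral_const_mul,
      intervalIntegral.integral_of_le (by norm_num), intervalIntegral.integral_of_le (by norm_num)]
    refine setIntegral_congr_fun measurableSet_Ioc fun x hx => ?_
    have hVx : ∫ ω, ψ (Y ω) (a * x + (1 + a)) ∂P = V x := by
      rw [hVdef, scaledMGF_of_lt hx.1]
      refine integral_congr_ae (ae_of_all _ fun ω => ?_)
      simp only
      rw [← hsnr, ha, snr_eq_gain_mul]
    simp only [hf]
    rw [hVx, show a * x + (1 + a) - 1 = a * (x + 1) by ring, Complex.real_smul, Complex.ofReal_sum,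
      Finset.sum_mul, Finset.mul_sum]
    refine Finset.sum_congr rfl fun i _ => ?_
    simp only [Complex.ofReal_mul]
    ring
  rw [hstep1, hstep2, hstep3, intervalIntegral.integral_finsetSum fun i _ => (hterm i).const_mul _]
  exact Finset.sum_congr rfl fun i _ => intervalIntegral.integral_const_mul _ _

theorem lemma2
    {Ω : Type*} [MeasurableSpace Ω] (P : Measure Ω) [IsProbabilityMeasure P]
    (α μ β lam m δ γ₀ κ d₀ RM w : ℝ) {l : ℕ} (B b : Fin l → ℝ)
    (hα : 0 < α) (hμ : 0 < μ) (hlam : 0 < lam) (hγ₀ : 0 < γ₀) (hd₀ : 0 < d₀) (hRM : 0 < RM)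
    (hm : max (2 / α) 1 < m) (hβ : 2 < β) (hδ : δ ∈ Set.Icc (2 : ℝ) 6)
    (hb : ∀ i, 0 ≤ b i) (hDpos : ∀ d, 0 ≤ rwpPDF d₀ RM B b d)
    (Hp Hf D : Ω → ℝ) (hHp : Measurable Hp) (hHf : Measurable Hf) (hD : Measurable D)
    (hind : iIndepFun ![Hp, Hf, D] P)
    (lawHp : P.map (fun ω => Hp ω ^ 2) =
      volume.withDensity (fun z => ENNReal.ofReal (pointingPDF β z)))
    (lawHf : P.map (fun ω => Hf ω ^ 2) =
      volume.withDensity (fun x => ENNReal.ofReal (alphaFPDF α μ m lam w x)))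
    (lawD : P.map D = volume.withDensity (fun d => ENNReal.ofReal (rwpPDF d₀ RM B b d)))
    (hw : (∫ ω, Hp ω ^ 2 ∂P) * w = 1)
    (s : ℂ) (hs : 0 < s.re) :
    (∀ N : ℕ,
      IntegrableOn (fun γ : ℝ =>
        snrPDF α μ β lam m δ γ₀ κ d₀ RM B b N γ * Complex.exp (-s * γ)) (Set.Ioi 0) ∧
      ∫ γ in Set.Ioi (0 : ℝ),
        snrPDF α μ β lam m δ γ₀ κ d₀ RM B b N γ * Complex.exp (-s * γ) =
          snrMGF α μ β lam m δ γ₀ κ d₀ RM B b N s) ∧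
    Tendsto (fun N : ℕ => snrMGF α μ β lam m δ γ₀ κ d₀ RM B b N s) atTop
      (𝓝 (complexMGF (fun ω => snr γ₀ δ κ d₀ (D ω) (Hp ω) (Hf ω)) P (-s))) := by
  have hm1 : 1 < m := (le_max_right _ _).trans_lt hm
  have hβ0 : 0 < β := by linarith
  have hδ0 : 0 < δ := by linarith [hδ.1]
  refine ⟨fun N => laplace_snrPDF B b hα hμ hlam hγ₀ hd₀ hRM hm1 hβ0 hs N, ?_⟩
  have hHp2 : Measurable fun ω => Hp ω ^ 2 := by fun_prop
  have hHf2 : Measurable fun ω => Hf ω ^ 2 := by fun_prop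
  -- The normalization of the powers turns the scale parameter of the fading density into `c₂`.
  have hmean : ∫ ω, Hp ω ^ 2 ∂P = β ^ 2 / (β + 2) ^ 2 := by
    rw [← integral_pointingPDF_mul_self hβ0, ← integral_map (f := fun z : ℝ => z)
      hHp2.aemeasurable aestronglyMeasurable_id,
      integral_eq_of_map_eq_withDensity (measurable_pointingPDF β) (pointingPDF_nonneg β) lawHp]
    simp only [smul_eq_mul]
  have hw' : w = ((β + 2) / β) ^ 2 := by
    rw [hmean] at hw
    field_simp at hw ⊢
    linarith
  have hw0 : 0 < w := by rw [hw']; positivity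
  have hr : c₂ α μ β lam m = (m - 1) * w ^ (α / 2) / (lam ^ (α / 2) * μ) := by
    rw [hw', ← Real.rpow_natCast, ← Real.rpow_mul (by positivity),
      show ((2 : ℕ) : ℝ) * (α / 2) = α by push_cast; ring,
      Real.div_rpow (by positivity) hβ0.le, c₂]
    field_simp
  have hc₂ : 0 < c₂ α μ β lam m := c₂_pos hμ hlam hm1 hβ0
  have hmeas : ∀ i, Measurable (![Hp, Hf, D] i) := by
    intro i
    fin_cases i <;> assumption
  have hindHpHf : IndepFun (fun ω => Hp ω ^ 2) (fun ω => Hf ω ^ 2) P :=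
    (hind.indepFun (show (0 : Fin 3) ≠ 1 by decide)).comp
      (φ := fun x : ℝ => x ^ 2) (ψ := fun x : ℝ => x ^ 2) (by fun_prop) (by fun_prop)
  have hindD : IndepFun (fun ω => Hp ω ^ 2 * Hf ω ^ 2) D P :=
    (hind.indepFun_prodMk hmeas 0 1 2 (by decide) (by decide)).comp
      (φ := fun p : ℝ × ℝ => p.1 ^ 2 * p.2 ^ 2) (ψ := fun x : ℝ => x) (by fun_prop) (by fun_prop)
  have hYpos : ∀ᵐ ω ∂P, 0 < Hp ω ^ 2 * Hf ω ^ 2 := by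
    filter_upwards [ae_mem_of_map_eq_withDensity hHp2 measurableSet_Ioo
      (fun z hz => pointingPDF_of_notMem hz) lawHp,
      ae_mem_of_map_eq_withDensity hHf2 measurableSet_Ioi
      (fun x hx => alphaFPDF_of_nonpos (not_lt.mp hx)) lawHf] with ω h1 h2
    exact mul_pos h1.1 h2
  set Y : Ω → ℝ := fun ω => Hp ω ^ 2 * Hf ω ^ 2 with hY
  have hV : ∀ x, -1 < x → scaledMGF P Y (gain γ₀ δ κ d₀ RM) s x =
      ((c₁ α μ β lam m * c₂ α μ β lam m ^ (-m) * (4 / Real.Gamma (μ + m)) : ℝ) : ℂ) *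
        mgfH α μ β m (((Real.log (Phi₂ α δ κ d₀ RM x / c₂ α μ β lam m) : ℝ) : ℂ) -
          α / 2 * Complex.log (s * γ₀)) := by
    intro x hx
    have hg := gain_pos (δ := δ) (κ := κ) hγ₀ hd₀ hRM hx
    have hΦ : 0 < Phi₂ α δ κ d₀ RM x := Phi_pos (by positivity) hx
    have hs0 : s ≠ 0 := by rintro rfl; simp at hs
    have hS : 0 < ((gain γ₀ δ κ d₀ RM x : ℂ) * s).re := by simpa using mul_pos hg hs
    have key := integral_exp_neg_mul_product hα hμ hlam hm1 hβ0 hw0 hr hc₂ hHp2 hHf2 hindHpHf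
      lawHp lawHf hS
    have hconst : β ^ 2 * α / (8 * ProbabilityTheory.beta μ m) * c₂ α μ β lam m ^ m *
        c₂ α μ β lam m ^ (-(μ + m)) * (4 / Real.Gamma (μ + m)) * c₂ α μ β lam m ^ μ =
        c₁ α μ β lam m * c₂ α μ β lam m ^ (-m) * (4 / Real.Gamma (μ + m)) := by
      have h1 : c₂ α μ β lam m ^ (-m) = c₂ α μ β lam m ^ (-(μ + m)) * c₂ α μ β lam m ^ μ := by
        rw [← Real.rpow_add hc₂]; ring_nf
      have h2 : c₁ α μ β lam m =
          β ^ 2 * α / (8 * ProbabilityTheory.beta μ m) * c₂ α μ β lam m ^ m := by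
        rw [c₁, c₂, mul_comm (β ^ α), mul_right_comm _ (β ^ α) μ]
      rw [h1, h2]
      ring
    have harg : ((-Real.log (c₂ α μ β lam m) : ℝ) : ℂ) -
        α / 2 * Complex.log ((gain γ₀ δ κ d₀ RM x : ℂ) * s) =
        ((Real.log (Phi₂ α δ κ d₀ RM x / c₂ α μ β lam m) : ℝ) : ℂ) -
          α / 2 * Complex.log (s * γ₀) := by
      rw [mul_comm s, Complex.log_ofReal_mul hg hs0, Complex.log_ofReal_mul hγ₀ hs0,
        Real.log_div hΦ.ne' hc₂.ne', log_Phi₂ hγ₀ hd₀ hRM hx]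
      push_cast
      ring
    rw [scaledMGF_of_lt hx, ← harg, ← hconst, ← key]
    refine integral_congr_ae (ae_of_all _ fun ω => ?_)
    simp only [hY]
    push_cast
    ring_nf
  rw [complexMGF_snr_eq hγ₀ hδ0 hd₀ hRM hb hDpos hHp hHf hD hindD hYpos lawD hs]
  simp only [snrMGF_eq_sum hd₀ hRM hV]
  refine tendsto_finsetSum _ fun i _ => (tendsto_sum_glWeight_mul ?_).const_mul _
  refine ContinuousOn.mul (Continuous.continuousOn ?_)
    (continuousOn_scaledMGF hs (by fun_prop) hYpos (fun x hx => (gain_pos hγ₀ hd₀ hRM hx).le)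
      (fun x hx => continuousAt_gain hd₀ hRM hx) (tendsto_gain hγ₀ hδ0 hd₀ hRM))
  exact Complex.continuous_ofReal.comp ((Real.continuous_rpow_const (hb i)).comp (by fun_prop))
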